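/- Let $Q=(Q_i^a)$, $1\le i\le N$, $1\le a\le r$, be an integer charge matrix, let $\mu^a(z)=\sum_i Q_i^a|z^i|^2$ be the moment map of the corresponding action of $U(1)^r$ on $\mathbb C^N$, and let $\eta\in\mathbb R^r$ be a regular value of $\mu$ (a point in the interior of a chamber). Let $X=\mu^{-1}(\eta)/U(1)^r$ be the toric quotient with its toric divisors $D_i=\{z^i=0\}\subset X$. For $t=(t^a)\in\mathbb C^r$, $t^{(2)}=(t^{ab})\in\mathbb C^{r\times r}$ and generic $\epsilon\in\mathbb C^N$ (meaning that the hyperplanes $\epsilon_i+\sum_aQ_i^a\phi_a=0$ in $\mathbb C^r$ have normal crossings) define $$F_\epsilon(t;t^{(2)})=\oint_C\prod_{a=1}^r\frac{d\phi_a}{2\pi \sqrt{-1}}\;\frac{\exp\big(\sum_a t^a\phi_a+\sum_{a,b}t^{ab}\phi_a\phi_b\big)}{\prod_{i=1}^N\big(\epsilon_i+\sum_aQ_i^a\phi_a\big)},$$ where $C$ is the Jeffrey–Kirwan contour of the chamber of $\eta$: the sum of the small tori $|\epsilon_i+\sum_aQ_i^a\phi_a|=\rho$ $(i\in B)$, one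 around the common zero of the forms indexed by $B$ for each $r$-element set $B$ such that $\{Q_i\}_{i\in B}$ is linearly independent and $\eta$ lies in the cone spanned by these vectors, oriented so that the residue of $\prod_a d\phi_a/\prod_{i\in B}(\epsilon_i+\sum_aQ_i^a\phi_a)$ is $1/|\det Q_B|$. Let $m=(m^{IJ})$ be complex numbers indexed by the ordered pairs $(I,J)$ (with $I=J$ allowed) for which $D_I\cap D_J$ is compact, and set, with all sums over these pairs, $$\epsilon\cdot m\cdot\epsilon=\sum m^{IJ}\epsilon_I\epsilon_J,\qquad \psi(\epsilon\cdot m)^a=\sum m^{IJ}(\epsilon_JQ_I^a+\epsilon_IQ_J^a),\qquad (\psi\cdot m)^{ab}=\sum m^{IJ}Q_I^aQ_J^b .$$ Then there is a polynomial $P$ in the variables $(t,t^{(2)},m)$, depending only on $Q$ and $\eta$, such that for all $t,t^{(2)},m$ $$F_\epsilon(t;t^{(2)})-e^{\epsilon\cdot m\cdot\epsilon}\,F_\epsilon\big(t+\psi(\epsilon\cdot m);\,t^{(2)}+\psi\cdot m\big)=P(t,t^{(2)},m)+O(\epsilon)$$ for generic $\epsilon$. Moreover the left-hand side is regular in $\epsilon$: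 for each $(t,t^{(2)},m)$ the $O(\epsilon)$ term is the restriction to generic $\epsilon$ of an entire function of $\epsilon\in\mathbb C^N$ that is $O(\epsilon)$ as $\epsilon\to0$. -/

import Mathlib

open Filter Topology Asymptotics

noncomputable section

namespace ToricVolume

variable {N r : ℕ}

/-! ### The toric quotient `X_η = μ⁻¹(η) / U(1)^r` and its divisors

`Q i a` is the charge `Q_i^a` of the coordinate `z^i` under the `a`-th circle. -/

/-- The moment map `μ^a(z) = ∑_i Q_i^a |z^i|²` of the torus action on `ℂ^N`. -/
def momentMap (Q : Matrix (Fin N) (Fin r) ℤ) (z : Fin N → ℂ) : Fin r → ℝ :=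
  fun a => ∑ i, (Q i a : ℝ) * ‖z i‖ ^ 2

/-- The fibre `μ⁻¹(η)`. -/
def levelSet (Q : Matrix (Fin N) (Fin r) ℤ) (η : Fin r → ℝ) : Set (Fin N → ℂ) :=
  {z | momentMap Q z = η}

/-- The charge vector `Q_i ∈ ℝ^r` of the `i`-th coordinate. -/
def charge (Q : Matrix (Fin N) (Fin r) ℤ) (i : Fin N) : Fin r → ℝ :=
  fun a => (Q i a : ℝ)

/-- `η` is a regular value of the moment map. The differential of `μ` at `z` has as its image
the span of the charge vectors `Q_i` with `z^i ≠ 0`. Equivalently, `η` lies on no cone spanned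
by fewer than `r` charge vectors, so it is in the interior of a chamber. -/
def IsRegularValue (Q : Matrix (Fin N) (Fin r) ℤ) (η : Fin r → ℝ) : Prop :=
  ∀ z ∈ levelSet Q η, Submodule.span ℝ (charge Q '' {i | z i ≠ 0}) = ⊤

/-- Two points of `μ⁻¹(η)` are equivalent when they lie on one orbit of
`U(1)^r`, which acts by `z^i ↦ exp (√-1 ∑_a Q_i^a ϑ_a) z^i`. -/
def torusOrbit (Q : Matrix (Fin N) (Fin r) ℤ) (η : Fin r → ℝ) : Setoid (levelSet Q η) where
  r z w := ∃ ϑ : Fin r → ℝ, ∀ i,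
    w.1 i = Complex.exp (Complex.I * ∑ a, (Q i a : ℂ) * (ϑ a : ℂ)) * z.1 i
  iseqv :=
    { refl := fun z => ⟨0, fun i => by simp⟩
      symm := by
        rintro z w ⟨ϑ, h⟩
        refine ⟨-ϑ, fun i => ?_⟩
        rw [h i, ← mul_assoc, ← Complex.exp_add]
        simp
      trans := by
        rintro z w v ⟨ϑ, h⟩ ⟨ϑ', h'⟩
        refine ⟨ϑ' + ϑ, fun i => ?_⟩
        rw [h' i, h i, ← mul_assoc, ← Complex.exp_add]
        simp [mul_add, Finset.sum_add_distrib] }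

/-- The symplectic quotient `X_η = μ⁻¹(η) / U(1)^r`, with the quotient topology. -/
abbrev SymplecticQuotient (Q : Matrix (Fin N) (Fin r) ℤ) (η : Fin r → ℝ) : Type :=
  Quotient (torusOrbit Q η)

/-- The toric divisor `D_i = {z^i = 0} ⊆ X_η`. -/
def toricDivisor (Q : Matrix (Fin N) (Fin r) ℤ) (η : Fin r → ℝ) (i : Fin N) :
    Set (SymplecticQuotient Q η) :=
  Quotient.mk (torusOrbit Q η) '' {z | z.1 i = 0}

/-- The (ordered) pairs `(I, J)` such that `D_I ∩ D_J` is compact. -/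
abbrev CompactPair (Q : Matrix (Fin N) (Fin r) ℤ) (η : Fin r → ℝ) : Type :=
  {IJ : Fin N × Fin N // IsCompact (toricDivisor Q η IJ.1 ∩ toricDivisor Q η IJ.2)}

instance (Q : Matrix (Fin N) (Fin r) ℤ) (η : Fin r → ℝ) : Fintype (CompactPair Q η) :=
  Fintype.ofFinite _

/-! ### The generating function -/

/-- The affine form `ε_i + Q_i^a φ_a`. -/
def divisorForm (Q : Matrix (Fin N) (Fin r) ℤ) (ε : Fin N → ℂ) (i : Fin N)
    (φ : Fin r → ℂ) : ℂ :=
  ε i + ∑ a, (Q i a : ℂ) * φ a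

/-- The integrand `exp (t^a φ_a + t^{ab} φ_a φ_b) / ∏_i (ε_i + Q_i^a φ_a)`. -/
def integrand (Q : Matrix (Fin N) (Fin r) ℤ) (ε : Fin N → ℂ) (t : Fin r → ℂ)
    (t₂ : Fin r → Fin r → ℂ) (φ : Fin r → ℂ) : ℂ :=
  Complex.exp (∑ a, t a * φ a + ∑ a, ∑ b, t₂ a b * φ a * φ b) / ∏ i, divisorForm Q ε i φ

/-- The equivariant parameters are generic when the polar hyperplanes `ε_i + Q_i^a φ_a = 0` have
normal crossings: at each point `φ`, those that pass through it have linearly independent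
charges. The complement is a finite union of proper linear subspaces of `ℂ^N`. -/
def IsGeneric (Q : Matrix (Fin N) (Fin r) ℤ) (ε : Fin N → ℂ) : Prop :=
  ∀ φ : Fin r → ℂ,
    LinearIndependent ℝ (fun i : {i : Fin N // divisorForm Q ε i φ = 0} => charge Q i.1)

/-- The `r × r` matrix of the charges selected by `σ`. -/
def chargeMinor (Q : Matrix (Fin N) (Fin r) ℤ) (σ : Fin r → Fin N) :
    Matrix (Fin r) (Fin r) ℂ :=
  Matrix.of fun k a => (Q (σ k) a : ℂ)

/-- The point `φ` at which the form `ε_{σ k} + Q_{σ k}^a φ_a` takes the value `u_k`, for every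
`k` (when `chargeMinor Q σ` is invertible). -/
def localPoint (Q : Matrix (Fin N) (Fin r) ℤ) (ε : Fin N → ℂ) (σ : Fin r → Fin N)
    (u : Fin r → ℂ) : Fin r → ℂ :=
  (chargeMinor Q σ)⁻¹.mulVec (fun k => u k - ε (σ k))

/-- The polydisc `|u_k| ≤ ρ` around the intersection point of the hyperplanes selected by `σ`
meets no other polar hyperplane. -/
def IsPolarRadius (Q : Matrix (Fin N) (Fin r) ℤ) (ε : Fin N → ℂ) (σ : Fin r → Fin N)
    (ρ : ℝ) : Prop :=
  0 < ρ ∧ ∀ u : Fin r → ℂ, (∀ k, ‖u k‖ ≤ ρ) →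
    ∀ j ∉ Set.range σ, divisorForm Q ε j (localPoint Q ε σ u) ≠ 0

open Classical in
/-- The integral `∮ ∏_a dφ_a / (2π√-1) f(φ)` over the small torus
`|ε_{σ k} + Q_{σ k}^a φ_a| = ρ`, `k = 1, …, r`, around the point where the hyperplanes selected by
`σ` meet. It is written in the coordinates `u_k = ε_{σ k} + Q_{σ k}^a φ_a`, with the
orientation of Jeffrey and Kirwan, for which the Jacobian is `1 / |det|`.
For `f = integrand Q ε t t₂` the value does not depend on which admissible `ρ` is chosen, and one
exists if `ε` is generic and the minor is invertible. -/
def torusResidue (Q : Matrix (Fin N) (Fin r) ℤ) (ε : Fin N → ℂ) (σ : Fin r → Fin N)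
    (f : (Fin r → ℂ) → ℂ) : ℂ :=
  if h : ∃ ρ : ℝ, IsPolarRadius Q ε σ ρ then
    (1 / (‖(chargeMinor Q σ).det‖ : ℂ)) * (1 / (2 * Real.pi * Complex.I) ^ r) *
      torusIntegral (fun u => f (localPoint Q ε σ u)) 0 (fun _ => h.choose)
  else 0

/-- The Jeffrey–Kirwan prescription: `σ` (which lists `r` indices in increasing order) selects
a pole when its charges are linearly independent and `η` is in the cone that they span. -/
def IsJKPole (Q : Matrix (Fin N) (Fin r) ℤ) (η : Fin r → ℝ) (σ : Fin r → Fin N) : Prop :=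
  StrictMono σ ∧ (chargeMinor Q σ).det ≠ 0 ∧
    ∃ p : Fin r → ℝ, (∀ k, 0 ≤ p k) ∧ ∀ a, ∑ k, (Q (σ k) a : ℝ) * p k = η a

open Classical in
/-- The generating function with quadratic higher times
`F_ε(t; t⁽²⁾) = ∮_C ∏_a dφ_a / (2π√-1) exp (t^a φ_a + t^{ab} φ_a φ_b) / ∏_i (ε_i + Q_i^a φ_a)`,
for generic `ε`. The contour `C` is the sum of the small tori around the poles that the
Jeffrey–Kirwan prescription selects for the chamber of `η`. -/
def generatingFunction (Q : Matrix (Fin N) (Fin r) ℤ) (η : Fin r → ℝ) (ε : Fin N → ℂ)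
    (t : Fin r → ℂ) (t₂ : Fin r → Fin r → ℂ) : ℂ :=
  ∑ σ : Fin r → Fin N with IsJKPole Q η σ, torusResidue Q ε σ (integrand Q ε t t₂)

/-! ### The shifts -/

variable {Q : Matrix (Fin N) (Fin r) ℤ} {η : Fin r → ℝ}

/-- `ε·m·ε = ∑ m^{IJ} ε_I ε_J`. -/
def quadShift (ε : Fin N → ℂ) (m : CompactPair Q η → ℂ) : ℂ :=
  ∑ p, m p * ε p.1.1 * ε p.1.2

/-- `ψ(ε·m)^a = ∑ m^{IJ} (ε_J Q_I^a + ε_I Q_J^a)`. -/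
def psiOne (ε : Fin N → ℂ) (m : CompactPair Q η → ℂ) : Fin r → ℂ :=
  fun a => ∑ p, m p * (ε p.1.2 * (Q p.1.1 a : ℂ) + ε p.1.1 * (Q p.1.2 a : ℂ))

/-- `(ψ·m)^{ab} = ∑ m^{IJ} Q_I^a Q_J^b`. -/
def psiTwo (m : CompactPair Q η → ℂ) : Fin r → Fin r → ℂ :=
  fun a b => ∑ p, m p * (Q p.1.1 a : ℂ) * (Q p.1.2 b : ℂ)

/-- The point `(t, t⁽²⁾, m)` at which a polynomial in these variables is evaluated. -/
def timesPoint (t : Fin r → ℂ) (t₂ : Fin r → Fin r → ℂ) (m : CompactPair Q η → ℂ) :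
    Fin r ⊕ (Fin r × Fin r) ⊕ CompactPair Q η → ℂ :=
  Sum.elim t (Sum.elim (fun ab => t₂ ab.1 ab.2) m)

end ToricVolume

end

open ToricVolume

/-! By Cauchy's formula (`torusResidue_integrand`), the residue at a Jeffrey–Kirwan pole `σ` is the
exponential at the vertex `φ_σ(ε)` divided by `|det Q_σ|` and by the values there of the other
forms, which are linear in `ε`. The shifts are the expansion of `∑ m^{IJ} D_I D_J` in powers of `φ`,
where `D_i = ε_i + Q_i^a φ_a` (`quadShift_add_phase`). The difference is therefore a sum over `σ` of
`exp(phase) - exp(phase + ∑ m^{IJ} D_I D_J)` at `φ_σ(ε)`, over the same denominators.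

The only possible poles in `ε` lie on the hyperplanes where some `j ∉ σ` passes through the vertex
of `σ`. For the `r + 1` indices `τ = σ ∪ {j}`, all vertices inside `τ` coincide there, and the
residues of the terms `τ \ {τ k}` agree up to the sign of the coefficient `c_k` in the linear
relation between the charges of `τ`. The selected `k` are the end points of `{p ≥ 0 : ∑ p_k Q_{τ k}
= η}`. If this set is bounded, there are two ends of opposite sign, or none, and the residues cancel
(`sum_sign_exit`). If it is unbounded, it gives a ray in the moment polytope, so `D_I ∩ D_J` is not
compact for `I, J ∉ τ` (`not_isCompact_of_ray`). Every admissible pair then meets `τ`, the exponent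
`∑ m^{IJ} D_I D_J` vanishes at the vertex, and each numerator is zero. Both cases are in
`sum_residue_circuit`.

With no residue at general points of the hyperplanes, the difference extends to an entire function
(`exists_entire_of_residues`). On a line `ε = s e` its value at `0` is the Taylor coefficient of
order `N - r` of a combination of exponentials of quadratics in `s`, hence polynomial in `(t, t⁽²⁾,
m)`. -/

noncomputable section

namespace ToricVolume

/-! ### Entire functions of several variables -/

section Entire

variable {E : Type*} [NormedAddCommGroup E] [NormedSpace ℂ E]

/-- Cauchy's formula for a directional derivative. -/
theorem fderiv_apply_eq_integral {g : E → ℂ} (hg : Differentiable ℂ g) (x v : E) :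
    fderiv ℂ g x v = (2 * Real.pi * Complex.I)⁻¹ *
      ∫ θ in (0 : ℝ)..2 * Real.pi, (circleMap 0 1 θ * Complex.I *
        (circleMap 0 1 θ ^ 2)⁻¹) * g (x + circleMap 0 1 θ • v) := by
  have hline : Differentiable ℂ fun s : ℂ => g (x + s • v) := by fun_prop
  have h1 : deriv (fun s : ℂ => g (x + s • v)) 0 = fderiv ℂ g x v := by
    have h := (hg (x + (0 : ℂ) • v)).hasFDerivAt.comp_hasDerivAt (0 : ℂ)
      (((hasDerivAt_id (0 : ℂ)).smul_const v).const_add x)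
    simpa [Function.comp_def] using h.deriv
  have h2 := DifferentiableOn.deriv_eq_smul_circleIntegral (c := 0) (R := 1) one_pos
    hline.differentiableOn
  rw [← h1, ← mul_right_inj' (Complex.two_pi_I_ne_zero), mul_inv_cancel_left₀ Complex.two_pi_I_ne_zero,
    ← smul_eq_mul, ← h2, circleIntegral]
  refine intervalIntegral.integral_congr fun θ _ => ?_
  simp [mul_assoc]

theorem eventually_apply_add_smul_ne_zero (l : E →L[ℂ] ℂ) {x w : E} (h : l x ≠ 0 ∨ l w ≠ 0) :
    ∀ᶠ s : ℂ in 𝓝[≠] 0, l (x + s • w) ≠ 0 := by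
  by_cases hx : l x = 0
  · filter_upwards [self_mem_nhdsWithin] with s hs
    simpa [hx] using ⟨hs, h.resolve_left (not_not.2 hx)⟩
  · have hc : Continuous fun s : ℂ => l (x + s • w) := by fun_prop
    exact nhdsWithin_le_nhds (hc.continuousAt.eventually_ne (by simpa using hx))

theorem tendsto_add_smul (x w : E) :
    Tendsto (fun s : ℂ => x + s • w) (𝓝[≠] 0) (𝓝 x) := by
  have hc : Continuous fun s : ℂ => x + s • w := by fun_prop
  simpa using (hc.tendsto 0).mono_left nhdsWithin_le_nhds

/-- Kernel inclusion makes the forms proportional; the cross-multiplied identity needs no division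
by `l v`. -/
theorem apply_mul_apply_eq_of_ker_le {l l' : E →L[ℂ] ℂ} (h : ∀ x, l x = 0 → l' x = 0) (v x : E) :
    l' x * l v = l' v * l x := by
  have := h (l v • x - l x • v) (by simp [mul_comm])
  simp only [map_sub, map_smul, smul_eq_mul] at this
  linear_combination this

theorem differentiable_finset_prod {κ : Type*} {f : κ → E → ℂ} {T : Finset κ}
    (hf : ∀ k ∈ T, Differentiable ℂ (f k)) : Differentiable ℂ fun x => ∏ k ∈ T, f k x := by
  classical
  induction T using Finset.induction_on with
  | empty => simp
  | insert k T hk ih =>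
    simp only [Finset.prod_insert hk]
    exact (hf k (Finset.mem_insert_self _ _)).mul
      (ih fun k' hk' => hf k' (Finset.mem_insert_of_mem hk'))

variable [FiniteDimensional ℂ E]

/-- Differentiation under the integral sign. -/
theorem differentiable_intervalIntegral {F : E → ℝ → ℂ} (a b : ℝ)
    (hF : ∀ θ, Differentiable ℂ fun x => F x θ)
    (hc : Continuous fun p : E × ℝ => F p.1 p.2)
    (hc' : Continuous fun p : E × ℝ => fderiv ℂ (fun x => F x p.2) p.1) :
    Differentiable ℂ fun x => ∫ θ in a..b, F x θ := by
  intro x₀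
  have : ProperSpace E := FiniteDimensional.proper ℂ E
  obtain ⟨C, hC⟩ := ((isCompact_closedBall x₀ 1).prod
    (isCompact_uIcc (a := a) (b := b))).exists_bound_of_continuousOn hc'.continuousOn
  refine (intervalIntegral.hasFDerivAt_integral_of_dominated_of_fderiv_le
    (F' := fun x θ => fderiv ℂ (fun x => F x θ) x) (bound := fun _ => C)
    (Metric.ball_mem_nhds x₀ one_pos) ?_ ?_ ?_ ?_ ?_ ?_).differentiableAt
  · exact Eventually.of_forall fun x =>
      (hc.comp (by fun_prop : Continuous fun θ : ℝ => (x, θ))).aestronglyMeasurable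
  · exact (hc.comp (by fun_prop : Continuous fun θ : ℝ => (x₀, θ))).intervalIntegrable _ _
  · exact (hc'.comp (by fun_prop : Continuous fun θ : ℝ => (x₀, θ))).aestronglyMeasurable
  · refine Eventually.of_forall fun θ hθ x hx => hC (x, θ) ⟨Metric.ball_subset_closedBall hx, ?_⟩
    exact Set.uIoc_subset_uIcc hθ
  · exact intervalIntegrable_const
  · exact Eventually.of_forall fun θ _ x _ => (hF θ x).hasFDerivAt

/-- Cauchy's integral expresses the derivative through values of `g` alone, so it inherits the
continuity of `g`. The same formula, differentiated under the integral, yields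
`differentiable_fderiv_apply`. -/
theorem continuous_fderiv_of_differentiable {g : E → ℂ} (hg : Differentiable ℂ g) :
    Continuous (fderiv ℂ g) := by
  rw [continuous_clm_apply]
  intro v
  simp only [fderiv_apply_eq_integral hg]
  refine continuous_const.mul (intervalIntegral.continuous_parametric_intervalIntegral_of_continuous'
    (f := fun x θ => (circleMap 0 1 θ * Complex.I *
        (circleMap 0 1 θ ^ 2)⁻¹) * g (x + circleMap 0 1 θ • v)) ?_ _ _)
  have hgc := hg.continuous
  have hcm : Continuous (circleMap 0 1) := continuous_circleMap 0 1
  have hne : ∀ θ, circleMap 0 1 θ ^ 2 ≠ 0 := fun θ => pow_ne_zero _ (circleMap_ne_center one_ne_zero)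
  unfold Function.uncurry
  refine Continuous.mul (Continuous.mul (by fun_prop) (Continuous.inv₀ (by fun_prop) fun p => hne _))
    (by fun_prop)

theorem differentiable_fderiv_apply {g : E → ℂ} (hg : Differentiable ℂ g) (v : E) :
    Differentiable ℂ fun x => fderiv ℂ g x v := by
  simp only [fderiv_apply_eq_integral hg]
  have hgc := hg.continuous
  have hg' := continuous_fderiv_of_differentiable hg
  have hcm : Continuous (circleMap 0 1) := continuous_circleMap 0 1
  have hne : ∀ θ, circleMap 0 1 θ ^ 2 ≠ 0 := fun θ => pow_ne_zero _ (circleMap_ne_center one_ne_zero)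
  have hk : Continuous fun θ => circleMap 0 1 θ * Complex.I * (circleMap 0 1 θ ^ 2)⁻¹ :=
    Continuous.mul (by fun_prop) (Continuous.inv₀ (by fun_prop) hne)
  refine (differentiable_const _).mul (differentiable_intervalIntegral _ _
    (fun θ => by fun_prop) ?_ ?_)
  · exact (hk.comp continuous_snd).mul (by fun_prop)
  · have : ∀ p : E × ℝ, fderiv ℂ (fun x => circleMap 0 1 p.2 * Complex.I *
        (circleMap 0 1 p.2 ^ 2)⁻¹ * g (x + circleMap 0 1 p.2 • v)) p.1 =
        (circleMap 0 1 p.2 * Complex.I * (circleMap 0 1 p.2 ^ 2)⁻¹) •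
          fderiv ℂ g (p.1 + circleMap 0 1 p.2 • v) := by
      intro p
      rw [fderiv_const_mul (by fun_prop), fderiv_comp_add_right]
    simp only [this]
    exact (hk.comp continuous_snd).smul (by fun_prop)

/-! ### Division by linear forms and removal of poles along hyperplanes -/

/-- An entire function that vanishes on a hyperplane is divisible by its equation. -/
theorem exists_eq_mul_of_vanish {g : E → ℂ} (hg : Differentiable ℂ g) (l : E →L[ℂ] ℂ) (hl : l ≠ 0)
    (hz : ∀ x, l x = 0 → g x = 0) :
    ∃ q : E → ℂ, Differentiable ℂ q ∧ ∀ x, g x = l x * q x := by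
  obtain ⟨w, hw⟩ : ∃ w, l w ≠ 0 := by
    by_contra! h
    exact hl (ContinuousLinearMap.ext h)
  obtain ⟨v, hv⟩ : ∃ v, l v = 1 := ⟨(l w)⁻¹ • w, by simp [hw]⟩
  set D : E → ℂ := fun x => fderiv ℂ g x v with hD
  have hDd : Differentiable ℂ D := differentiable_fderiv_apply hg v
  have hDc := hDd.continuous
  have hD' := continuous_fderiv_of_differentiable hDd
  -- Hadamard's lemma: `l (Λ θ x) = θ * l x`, so `Λ` moves `x` along `v` from the kernel (`θ = 0`)
  -- to itself (`θ = 1`). The quotient is the mean of the derivative along `v` over this path.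
  let Λ : ℝ → E →L[ℂ] E := fun θ =>
    ContinuousLinearMap.id ℂ E + ((θ : ℂ) - 1) • l.smulRight v
  have hΛ : Continuous Λ := by fun_prop
  have hΛx : ∀ θ x, Λ θ x = x + (((θ : ℂ) - 1) * l x) • v := fun θ x => by
    simp [Λ, smul_smul]
  refine ⟨fun x => ∫ θ in (0 : ℝ)..1, D (Λ θ x), ?_, fun x => ?_⟩
  · refine differentiable_intervalIntegral _ _ (fun θ => by fun_prop) ?_ ?_
    · exact hDc.comp ((hΛ.comp continuous_snd).clm_apply continuous_fst)
    · have : ∀ p : E × ℝ, fderiv ℂ (fun x => D (Λ p.2 x)) p.1 =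
          (fderiv ℂ D (Λ p.2 p.1)).comp (Λ p.2) := fun p => by
        rw [fderiv_fun_comp _ (hDd _) (by fun_prop), ContinuousLinearMap.fderiv]
      simp only [this]
      exact (hD'.comp ((hΛ.comp continuous_snd).clm_apply continuous_fst)).clm_comp
        (hΛ.comp continuous_snd)
  · have hder : ∀ θ ∈ Set.uIcc (0 : ℝ) 1,
        HasDerivAt (fun θ : ℝ => g (Λ θ x)) (l x * D (Λ θ x)) θ := by
      intro θ _
      have h1 : HasDerivAt (fun s : ℂ => x + ((s - 1) * l x) • v) ((1 * l x) • v) (θ : ℂ) :=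
        ((((hasDerivAt_id (θ : ℂ)).sub_const 1).mul_const (l x)).smul_const v).const_add x
      have h2 := ((hg (x + (((θ : ℂ) - 1) * l x) • v)).hasFDerivAt.comp_hasDerivAt (θ : ℂ)
        h1).comp_ofReal
      simp only [hΛx, hD]
      convert h2 using 1
      · rfl
      · rw [one_mul, map_smul, smul_eq_mul]
    have hint := intervalIntegral.integral_eq_sub_of_hasDerivAt hder
      (by
        refine Continuous.intervalIntegrable ?_ _ _
        exact continuous_const.mul (hDc.comp (hΛ.clm_apply continuous_const)))
    rw [intervalIntegral.integral_const_mul] at hint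
    have h0 : g (Λ 0 x) = 0 := hz _ (by simp [hΛx, hv])
    rw [hint, h0, hΛx]
    simp

/-- A quotient of an entire function by linear forms extends to an entire function if it has no
poles at the general points of the hyperplanes. -/
theorem exists_entire_of_tendsto {κ : Type*} (S : Finset κ) (l : κ → E →L[ℂ] ℂ)
    (hl : ∀ k ∈ S, l k ≠ 0) (G : E → ℂ)
    (hG : ∃ g : E → ℂ, Differentiable ℂ g ∧
      ∀ x, (∀ k ∈ S, l k x ≠ 0) → g x = (∏ k ∈ S, l k x) * G x)
    (hres : ∀ k ∈ S, ∀ e, l k e = 0 →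
      (∀ k' ∈ S, l k' e = 0 → ∀ x, l k x = 0 → l k' x = 0) →
      ∃ v, l k v ≠ 0 ∧ Tendsto (fun s : ℂ => s * G (e + s • v)) (𝓝[≠] 0) (𝓝 0)) :
    ∃ R : E → ℂ, Differentiable ℂ R ∧ ∀ x, (∀ k ∈ S, l k x ≠ 0) → R x = G x := by
  classical
  -- `T` holds the factors still to be divided out. Genericity stays relative to all of `S`, so
  -- repeated or proportional forms cause no difficulty.
  suffices H : ∀ T : Finset κ, T ⊆ S → (∃ g : E → ℂ, Differentiable ℂ g ∧
      ∀ x, (∀ k ∈ S, l k x ≠ 0) → g x = (∏ k ∈ T, l k x) * G x) →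
      ∃ R : E → ℂ, Differentiable ℂ R ∧ ∀ x, (∀ k ∈ S, l k x ≠ 0) → R x = G x from
    H S subset_rfl hG
  intro T
  induction T using Finset.induction_on with
  | empty => simp
  | insert k T hkT ih =>
    rintro hTS ⟨g, hg, hgG⟩
    have hkS : k ∈ S := hTS (Finset.mem_insert_self _ _)
    have hgen : ∀ e, l k e = 0 → (∀ k' ∈ S, l k' e = 0 → ∀ x, l k x = 0 → l k' x = 0) →
        g e = 0 := by
      intro e he hek
      obtain ⟨v, hv, hlim⟩ := hres k hkS e he hek
      have hev : ∀ᶠ s : ℂ in 𝓝[≠] 0, ∀ k' ∈ S, l k' (e + s • v) ≠ 0 := by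
        rw [Finset.eventually_all]
        intro k' hk'
        refine eventually_apply_add_smul_ne_zero _ (or_iff_not_imp_left.2 fun h0 hv' => ?_)
        refine hl k' hk' (ContinuousLinearMap.ext fun x => ?_)
        have := apply_mul_apply_eq_of_ker_le (hek k' hk' (not_not.1 h0)) v x
        simpa [hv', hv] using this
      have h1 : Tendsto (fun s : ℂ => g (e + s • v)) (𝓝[≠] 0) (𝓝 (g e)) :=
        (hg.continuous.tendsto e).comp (tendsto_add_smul e v)
      have hc : Continuous fun x => ∏ k ∈ T, l k x := by fun_prop
      have h2 : Tendsto (fun s : ℂ => (l k v * ∏ k ∈ T, l k (e + s • v)) * (s * G (e + s • v)))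
          (𝓝[≠] 0) (𝓝 ((l k v * ∏ k ∈ T, l k e) * 0)) :=
        (((hc.tendsto e).comp (tendsto_add_smul e v)).const_mul _).mul hlim
      rw [mul_zero] at h2
      refine tendsto_nhds_unique (h1.congr' ?_) h2
      filter_upwards [hev] with s hs
      rw [hgG _ hs, Finset.prod_insert hkT]
      simp only [map_add, map_smul, he, smul_eq_mul]
      ring
    have hvan : ∀ x, l k x = 0 → g x = 0 := by
      intro x hx
      let ι := {k' : κ // k' ∈ S ∧ ¬ ∀ x, l k x = 0 → l k' x = 0}
      -- A direction `w` inside the hyperplane that avoids the finitely many others: the points `x +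
      -- s • w` are general for small `s ≠ 0`, and vanishing passes to `x` by continuity.
      have : Finite ι := Finite.of_injective (fun i : ι => (⟨i.1, i.2.1⟩ : S))
        fun a b h => Subtype.ext (by simpa using h)
      obtain ⟨w, hw, hw'⟩ := Module.Dual.exists_forall_mem_ne_zero_of_forall_exists
        (LinearMap.ker (l k : E →ₗ[ℂ] ℂ)) (fun i : ι => (l i.1 : E →ₗ[ℂ] ℂ)) (fun i => by
          have := i.2.2
          push Not at this
          simpa using this)
      have hw : l k w = 0 := by simpa using hw
      have hev : ∀ᶠ s : ℂ in 𝓝[≠] 0, ∀ k' ∈ S, (¬ ∀ x, l k x = 0 → l k' x = 0) →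
          l k' (x + s • w) ≠ 0 := by
        rw [Finset.eventually_all]
        intro k' hk'
        by_cases h : ∀ x, l k x = 0 → l k' x = 0
        · exact Eventually.of_forall fun _ h' => absurd h h'
        · exact (eventually_apply_add_smul_ne_zero _ (Or.inr (hw' ⟨k', hk', h⟩))).mono
            fun _ hs _ => hs
      have h1 : Tendsto (fun s : ℂ => g (x + s • w)) (𝓝[≠] 0) (𝓝 (g x)) :=
        (hg.continuous.tendsto x).comp (tendsto_add_smul x w)
      refine tendsto_nhds_unique (h1.congr' (f₂ := fun _ => 0) ?_) tendsto_const_nhds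
      filter_upwards [hev] with s hs
      refine hgen _ (by simp [hx, hw]) fun k' hk' h0 => ?_
      by_contra h
      exact hs k' hk' h h0
    obtain ⟨q, hq, hgq⟩ := exists_eq_mul_of_vanish hg (l k) (hl k hkS) hvan
    refine ih ((Finset.subset_insert _ _).trans hTS) ⟨q, hq, fun x hx => ?_⟩
    have := hgG x hx
    rw [Finset.prod_insert hkT, hgq, mul_assoc] at this
    exact mul_left_cancel₀ (hx k hkS) this

/-- A sum of simple fractions extends to an entire function if its residues at the general points
of the polar hyperplanes cancel. -/
theorem exists_entire_of_residues {ι J : Type*} [Fintype ι] [DecidableEq J] (κ : ι → Finset J)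
    (l : ι → J → E →L[ℂ] ℂ) (hl : ∀ i, ∀ j ∈ κ i, l i j ≠ 0) (A : ι → E → ℂ)
    (hA : ∀ i, Differentiable ℂ (A i))
    (hdist : ∀ i, ∀ j ∈ κ i, ∀ j' ∈ κ i, j ≠ j' → ¬ ∀ x, l i j x = 0 → l i j' x = 0)
    (hres : ∀ i₀, ∀ j₀ ∈ κ i₀, ∀ e v, l i₀ j₀ e = 0 → l i₀ j₀ v ≠ 0 →
      (∀ i, ∀ j ∈ κ i, l i j e = 0 → ∀ x, l i₀ j₀ x = 0 → l i j x = 0) →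
      ∑ i, ∑ j ∈ κ i with l i j e = 0,
        A i e / (l i j v * ∏ j' ∈ (κ i).erase j, l i j' e) = 0) :
    ∃ R : E → ℂ, Differentiable ℂ R ∧ ∀ x, (∀ i, ∀ j ∈ κ i, l i j x ≠ 0) →
      R x = ∑ i, A i x / ∏ j ∈ κ i, l i j x := by
  classical
  have hmem : ∀ p : (Σ _ : ι, J), p ∈ Finset.univ.sigma κ ↔ p.2 ∈ κ p.1 := by simp
  refine (exists_entire_of_tendsto (Finset.univ.sigma κ)
    (fun p : (Σ _ : ι, J) => l p.1 p.2) (fun p hp => hl _ _ ((hmem p).1 hp))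
    (fun x => ∑ i, A i x / ∏ j ∈ κ i, l i j x)
    ⟨fun x => ∑ i, A i x * ∏ i' ∈ Finset.univ.erase i, ∏ j ∈ κ i', l i' j x, ?_, ?_⟩ ?_).imp
    fun R hR => ⟨hR.1, fun x hx => hR.2 x fun p hp => hx _ _ ((hmem p).1 hp)⟩
  · exact Differentiable.fun_sum fun i _ => (hA i).mul <|
      differentiable_finset_prod fun i' _ => differentiable_finset_prod fun j _ =>
        (l i' j).differentiable
  · intro x hx
    have hx' : ∀ i, ∏ j ∈ κ i, l i j x ≠ 0 := fun i =>
      Finset.prod_ne_zero_iff.2 fun j hj => hx ⟨i, j⟩ ((hmem _).2 hj)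
    rw [Finset.prod_sigma, Finset.mul_sum]
    refine Finset.sum_congr rfl fun i _ => ?_
    rw [← Finset.mul_prod_erase Finset.univ _ (Finset.mem_univ i)]
    field_simp [hx' i]
  · rintro ⟨i₀, j₀⟩ hp e he hgen
    have hj₀ : j₀ ∈ κ i₀ := (hmem _).1 hp
    have hgen' : ∀ i, ∀ j ∈ κ i, l i j e = 0 → ∀ x, l i₀ j₀ x = 0 → l i j x = 0 :=
      fun i j hj => hgen ⟨i, j⟩ ((hmem _).2 hj)
    obtain ⟨v, hv⟩ : ∃ v, l i₀ j₀ v ≠ 0 := by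
      by_contra! h
      exact hl i₀ j₀ hj₀ (ContinuousLinearMap.ext h)
    refine ⟨v, hv, ?_⟩
    have hlv : ∀ i, ∀ j ∈ κ i, l i j e = 0 → l i j v ≠ 0 := by
      intro i j hj h0 hv'
      refine hl i j hj (ContinuousLinearMap.ext fun x => ?_)
      have := apply_mul_apply_eq_of_ker_le (hgen' i j hj h0) v x
      simpa [hv', hv] using this
    suffices H : Tendsto (fun s : ℂ => s * ∑ i, A i (e + s • v) / ∏ j ∈ κ i, l i j (e + s • v))
        (𝓝[≠] 0) (𝓝 (∑ i, ∑ j ∈ κ i with l i j e = 0,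
          A i e / (l i j v * ∏ j' ∈ (κ i).erase j, l i j' e))) by
      rwa [hres i₀ j₀ hj₀ e v he hv hgen'] at H
    simp only [Finset.mul_sum]
    refine tendsto_finsetSum _ fun i _ => ?_
    have hAt : Tendsto (fun s : ℂ => A i (e + s • v)) (𝓝[≠] 0) (𝓝 (A i e)) :=
      ((hA i).continuous.tendsto e).comp (tendsto_add_smul e v)
    have hprod : ∀ T : Finset J, Tendsto (fun s : ℂ => ∏ j ∈ T, l i j (e + s • v)) (𝓝[≠] 0)
        (𝓝 (∏ j ∈ T, l i j e)) := fun T => by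
      have hc : Continuous fun x => ∏ j ∈ T, l i j x := by fun_prop
      exact (hc.tendsto e).comp (tendsto_add_smul e v)
    by_cases h : ∃ j ∈ κ i, l i j e = 0
    · obtain ⟨j, hj, hj0⟩ := h
      -- By `hdist` the hyperplanes of one fraction are distinct, so at a general point at most one
      -- factor vanishes and the pole is simple.
      have huniq : ∀ j' ∈ κ i, l i j' e = 0 → j' = j := by
        intro j' hj' hj'0
        by_contra hne
        refine hdist i j' hj' j hj hne fun x hx => hgen' i j hj hj0 x ?_
        have := apply_mul_apply_eq_of_ker_le (hgen' i j' hj' hj'0) v x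
        rw [hx, zero_mul] at this
        exact (mul_eq_zero.1 this.symm).resolve_left (hlv i j' hj' hj'0)
      have hfilter : (κ i).filter (fun j => l i j e = 0) = {j} := by
        ext j'
        simp only [Finset.mem_filter, Finset.mem_singleton]
        exact ⟨fun h => huniq j' h.1 h.2, fun h => h ▸ ⟨hj, hj0⟩⟩
      rw [hfilter, Finset.sum_singleton]
      have hne : ∏ j' ∈ (κ i).erase j, l i j' e ≠ 0 := Finset.prod_ne_zero_iff.2 fun j' hj' h0 =>
        (Finset.mem_erase.1 hj').1 (huniq j' (Finset.mem_of_mem_erase hj') h0)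
      refine (hAt.div ((hprod ((κ i).erase j)).const_mul (l i j v))
        (mul_ne_zero (hlv i j hj hj0) hne)).congr' ?_
      filter_upwards [self_mem_nhdsWithin] with s hs
      have hs : s ≠ 0 := hs
      rw [← Finset.mul_prod_erase _ _ hj]
      have : l i j (e + s • v) = s * l i j v := by simp [hj0]
      rw [this, mul_assoc, ← mul_div_assoc, mul_div_mul_left _ _ hs]
      rfl
    · push Not at h
      have hfilter : (κ i).filter (fun j => l i j e = 0) = ∅ := by
        rw [Finset.filter_eq_empty_iff]
        exact fun j hj => h j hj
      rw [hfilter, Finset.sum_empty]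
      have h0 : Tendsto (fun s : ℂ => s) (𝓝[≠] 0) (𝓝 0) := tendsto_id.mono_left nhdsWithin_le_nhds
      simpa using h0.mul (hAt.div (hprod (κ i)) (Finset.prod_ne_zero_iff.2 h))

end Entire

/-! ### Residues at simple normal crossings -/

/-- Cauchy's formula on a polydisc. -/
theorem torusIntegral_div_prod {ρ : ℝ} (hρ : 0 < ρ) : ∀ {n : ℕ} (f : (Fin n → ℂ) → ℂ),
    (∀ u, (∀ k, ‖u k‖ ≤ ρ) → DifferentiableAt ℂ f u) →
    torusIntegral (fun u => f u / ∏ k, u k) 0 (fun _ => ρ) =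
      (2 * Real.pi * Complex.I) ^ n * f 0
  | 0, f, _ => by simp
  | n + 1, f, hf => by
    have hint : TorusIntegrable (fun u => f u / ∏ k, u k) 0 (fun _ => ρ) := by
      refine Continuous.integrableOn_Icc ?_
      have hm : Continuous (torusMap (n := n + 1) 0 (fun _ => ρ)) := by
        unfold torusMap
        fun_prop
      refine Continuous.div ?_ (by fun_prop) fun θ => ?_
      · refine continuous_iff_continuousAt.2 fun θ => ContinuousAt.comp (g := f) ?_ hm.continuousAt
        refine (hf _ fun k => ?_).continuousAt
        simp [torusMap, abs_of_pos hρ]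
      · exact Finset.prod_ne_zero_iff.2 fun k _ => by simp [torusMap, hρ.ne', Complex.exp_ne_zero]
    rw [torusIntegral_succ hint]
    have hinner : ∀ x ∈ Metric.sphere (0 : ℂ) ρ,
        torusIntegral (fun y : Fin n → ℂ => f (Fin.cons x y) / ∏ k, (Fin.cons x y : Fin (n + 1) → ℂ) k)
          0 (fun _ => ρ) = (x - 0)⁻¹ • ((2 * Real.pi * Complex.I) ^ n * f (Fin.cons x 0)) := by
      intro x hx
      have hx : ‖x‖ = ρ := by simpa using hx
      have := torusIntegral_div_prod hρ (fun y : Fin n → ℂ => f (Fin.cons x y)) fun y hy => by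
        have h1 : DifferentiableAt ℂ f (Fin.cons x y) := hf _ fun k => by
          refine Fin.cases ?_ (fun k => ?_) k
          · simp [hx]
          · simpa using hy k
        have h2 : DifferentiableAt ℂ (fun y : Fin n → ℂ => (Fin.cons x y : Fin (n + 1) → ℂ)) y := by
          rw [differentiableAt_pi]
          intro k
          refine Fin.cases ?_ (fun k => ?_) k
          · simp
          · simp only [Fin.cons_succ]
            fun_prop
        exact h1.comp y h2
      rw [← this, sub_zero, smul_eq_mul, ← torusIntegral_const_mul]
      congr 1
      funext y
      rw [Fin.prod_univ_succ]
      simp only [Fin.cons_zero, Fin.cons_succ]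
      rw [div_mul_eq_div_div_swap, div_eq_inv_mul _ x]
    have hz : ((0 : Fin (n + 1) → ℂ) ∘ Fin.succ) = 0 := rfl
    have hr : ((fun _ : Fin (n + 1) => ρ) ∘ Fin.succ) = fun _ => ρ := rfl
    rw [hz, hr]
    rw [circleIntegral.integral_congr (f := fun x => torusIntegral (fun y : Fin n → ℂ =>
      f (Fin.cons x y) / ∏ k, (Fin.cons x y : Fin (n + 1) → ℂ) k) 0 (fun _ => ρ))
      (c := (0 : Fin (n + 1) → ℂ) 0) hρ.le (fun x hx => hinner x hx)]
    have hd : DifferentiableOn ℂ (fun x : ℂ => (2 * Real.pi * Complex.I) ^ n * f (Fin.cons x 0))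
        (Metric.closedBall 0 ρ) := by
      intro x hx
      have hx : ‖x‖ ≤ ρ := by simpa using hx
      have h1 : DifferentiableAt ℂ f (Fin.cons x 0) := hf _ fun k => by
        refine Fin.cases ?_ (fun k => ?_) k
        · simpa using hx
        · simp [hρ.le]
      have h2 : DifferentiableAt ℂ (fun x : ℂ => (Fin.cons x 0 : Fin (n + 1) → ℂ)) x := by
        rw [differentiableAt_pi]
        intro k
        refine Fin.cases ?_ (fun k => ?_) k
        · simp only [Fin.cons_zero]
          fun_prop
        · simp
      exact ((h1.comp x h2).const_mul _).differentiableWithinAt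
    have := hd.circleIntegral_sub_inv_smul (w := 0) (Metric.mem_ball_self hρ)
    have hcons : (Fin.cons 0 0 : Fin (n + 1) → ℂ) = 0 := by
      funext k
      refine Fin.cases ?_ (fun k => ?_) k <;> simp
    rw [hcons, smul_eq_mul] at this
    refine Eq.trans ?_ (this.trans ?_)
    · rfl
    · ring

/-! ### Vertices of the polar arrangement and the residues there -/

variable {N r : ℕ} (Q : Matrix (Fin N) (Fin r) ℤ)

theorem divisorForm_localPoint (ε : Fin N → ℂ) {σ : Fin r → Fin N}
    (hdet : (chargeMinor Q σ).det ≠ 0) (u : Fin r → ℂ) (k : Fin r) :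
    divisorForm Q ε (σ k) (localPoint Q ε σ u) = u k := by
  have h : (chargeMinor Q σ).mulVec (localPoint Q ε σ u) = fun k => u k - ε (σ k) := by
    rw [localPoint, Matrix.mulVec_mulVec, Matrix.mul_nonsing_inv _ (isUnit_iff_ne_zero.2 hdet),
      Matrix.one_mulVec]
  have hk := congrFun h k
  simp only [Matrix.mulVec, dotProduct, chargeMinor, Matrix.of_apply] at hk
  rw [divisorForm, hk]
  ring

theorem eq_localPoint (ε : Fin N → ℂ) {σ : Fin r → Fin N}
    (hdet : (chargeMinor Q σ).det ≠ 0) {u φ : Fin r → ℂ}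
    (h : ∀ k, divisorForm Q ε (σ k) φ = u k) : φ = localPoint Q ε σ u := by
  have h' : (chargeMinor Q σ).mulVec φ = fun k => u k - ε (σ k) := by
    funext k
    rw [← h k]
    simp [Matrix.mulVec, dotProduct, chargeMinor, divisorForm]
  rw [localPoint, ← h', Matrix.mulVec_mulVec, Matrix.nonsing_inv_mul _ (isUnit_iff_ne_zero.2 hdet),
    Matrix.one_mulVec]

/-- The intersection point of the hyperplanes selected by `σ`, as a linear function of `ε`. -/
def vertex (σ : Fin r → Fin N) : (Fin N → ℂ) →L[ℂ] (Fin r → ℂ) :=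
  LinearMap.toContinuousLinearMap
    { toFun := fun ε => localPoint Q ε σ 0
      map_add' := fun ε ε' => by
        rw [localPoint, localPoint, localPoint, ← Matrix.mulVec_add]
        congr 1
        funext k
        simp
        ring
      map_smul' := fun c ε => by
        rw [localPoint, localPoint, RingHom.id_apply, ← Matrix.mulVec_smul]
        congr 1
        funext k
        simp }

theorem vertex_apply (σ : Fin r → Fin N) (ε : Fin N → ℂ) :
    vertex Q σ ε = localPoint Q ε σ 0 := rfl

/-- The value of the `j`-th form at the vertex selected by `σ`, as a linear function of `ε`. -/
def vertexForm (σ : Fin r → Fin N) (j : Fin N) : (Fin N → ℂ) →L[ℂ] ℂ :=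
  ContinuousLinearMap.proj j + ∑ a, (Q j a : ℂ) • (ContinuousLinearMap.proj a ∘L vertex Q σ)

theorem vertexForm_apply (σ : Fin r → Fin N) (j : Fin N) (ε : Fin N → ℂ) :
    vertexForm Q σ j ε = divisorForm Q ε j (vertex Q σ ε) := by
  simp [vertexForm, divisorForm]

/-- The vertex of `σ` depends only on the parameters `ε (σ k)`. Hence, for fixed `σ`, the forms with
`j` outside `σ` are nonzero and pairwise not proportional. -/
theorem vertexForm_single {σ : Fin r → Fin N} {i j : Fin N} (hi : i ∉ Set.range σ) :
    vertexForm Q σ j (Pi.single i 1) = if j = i then 1 else 0 := by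
  have h : vertex Q σ (Pi.single i 1) = 0 := by
    rw [vertex_apply, localPoint]
    have h0 : (fun k => (0 : Fin r → ℂ) k - (Pi.single i 1 : Fin N → ℂ) (σ k)) = 0 := by
      funext k
      have : σ k ≠ i := fun h => hi ⟨_, h⟩
      simp [this]
    rw [h0, Matrix.mulVec_zero]
  rw [vertexForm_apply, h, divisorForm]
  simp [Pi.single_apply]

/-- The exponent `t^a φ_a + t^{ab} φ_a φ_b`. -/
def phase (t : Fin r → ℂ) (t₂ : Fin r → Fin r → ℂ) (φ : Fin r → ℂ) : ℂ :=
  ∑ a, t a * φ a + ∑ a, ∑ b, t₂ a b * φ a * φ b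

/-- Otherwise `r + 1` hyperplanes would meet at the vertex, with independent charges in `ℝ^r`. -/
theorem vertexForm_ne_zero_of_isGeneric {ε : Fin N → ℂ} (hε : IsGeneric Q ε) {σ : Fin r → Fin N}
    (hσ : Function.Injective σ) (hdet : (chargeMinor Q σ).det ≠ 0) {j : Fin N}
    (hj : j ∉ Set.range σ) : vertexForm Q σ j ε ≠ 0 := by
  classical
  intro h0
  rw [vertexForm_apply] at h0
  have hcard := (hε (vertex Q σ ε)).fintype_card_le_finrank
  let e : Fin (r + 1) → {i : Fin N // divisorForm Q ε i (vertex Q σ ε) = 0} :=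
    Fin.cons ⟨j, h0⟩ fun k => ⟨σ k, divisorForm_localPoint Q ε hdet 0 k⟩
  have he : Function.Injective e := by
    refine Fin.cons_injective_iff.2 ⟨?_, fun a b h => hσ (Subtype.ext_iff.1 h)⟩
    rintro ⟨k, hk⟩
    exact hj ⟨k, Subtype.ext_iff.1 hk⟩
  have := Fintype.card_le_of_injective e he
  simp at this hcard
  omega

theorem exists_isPolarRadius {ε : Fin N → ℂ} {σ : Fin r → Fin N}
    (h : ∀ j ∉ Set.range σ, vertexForm Q σ j ε ≠ 0) : ∃ ρ, IsPolarRadius Q ε σ ρ := by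
  have hev : ∀ᶠ u : Fin r → ℂ in 𝓝 0, ∀ j, j ∉ Set.range σ →
      divisorForm Q ε j (localPoint Q ε σ u) ≠ 0 := by
    rw [eventually_all]
    intro j
    by_cases hj : j ∈ Set.range σ
    · exact Eventually.of_forall fun _ h => absurd hj h
    · have hc : Continuous fun u => divisorForm Q ε j (localPoint Q ε σ u) := by
        unfold divisorForm localPoint
        fun_prop
      have h0 : divisorForm Q ε j (localPoint Q ε σ 0) ≠ 0 := by
        simpa [vertexForm_apply, vertex_apply] using h j hj
      exact (hc.continuousAt.eventually_ne h0).mono fun _ hu _ => hu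
  obtain ⟨ρ, hρ, hball⟩ := Metric.nhds_basis_closedBall.eventually_iff.1 hev
  refine ⟨ρ, hρ, fun u hu j hj => hball ?_ j hj⟩
  simpa [pi_norm_le_iff_of_nonneg hρ.le] using hu

open Classical in
theorem prod_eq_prod_comp_mul_prod_compl {σ : Fin r → Fin N} (hσ : Function.Injective σ) (f : Fin N → ℂ) :
    ∏ i, f i = (∏ k, f (σ k)) * ∏ j ∈ (Finset.univ.image σ)ᶜ, f j := by
  rw [← Finset.prod_mul_prod_compl (Finset.univ.image σ), Finset.prod_image fun _ _ _ _ h => hσ h]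

-- In the coordinates `u` the forms of `σ` are the coordinates themselves and the others have no
-- zero on the polydisc, so Cauchy's formula evaluates at `u = 0`, whatever the chosen radius.
open Classical in
theorem torusResidue_integrand {ε : Fin N → ℂ} {σ : Fin r → Fin N}
    (hσ : Function.Injective σ) (hdet : (chargeMinor Q σ).det ≠ 0)
    (hne : ∀ j ∉ Set.range σ, vertexForm Q σ j ε ≠ 0)
    (t : Fin r → ℂ) (t₂ : Fin r → Fin r → ℂ) :
    torusResidue Q ε σ (integrand Q ε t t₂) =
      (‖(chargeMinor Q σ).det‖ : ℂ)⁻¹ * Complex.exp (phase t t₂ (vertex Q σ ε)) /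
        ∏ j ∈ (Finset.univ.image σ)ᶜ, vertexForm Q σ j ε := by
  have h := exists_isPolarRadius Q hne
  rw [torusResidue, dif_pos h]
  obtain ⟨hρ, hpol⟩ := h.choose_spec
  set ρ := h.choose
  have hfun : (fun u => integrand Q ε t t₂ (localPoint Q ε σ u)) = fun u =>
      (Complex.exp (phase t t₂ (localPoint Q ε σ u)) /
        ∏ j ∈ (Finset.univ.image σ)ᶜ, divisorForm Q ε j (localPoint Q ε σ u)) / ∏ k, u k := by
    funext u
    rw [integrand, prod_eq_prod_comp_mul_prod_compl hσ, phase, div_div, mul_comm]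
    simp only [divisorForm_localPoint Q ε hdet]
  rw [hfun, torusIntegral_div_prod hρ]
  · simp only [vertexForm_apply, vertex_apply]
    have : (2 * Real.pi * Complex.I) ^ r ≠ 0 := pow_ne_zero _ Complex.two_pi_I_ne_zero
    field_simp
  · intro u hu
    have hl : Differentiable ℂ fun u => localPoint Q ε σ u := by
      rw [differentiable_pi]
      intro k
      simp only [localPoint, Matrix.mulVec, dotProduct]
      fun_prop
    simp only [div_eq_mul_inv]
    refine DifferentiableAt.mul ?_ (DifferentiableAt.fun_inv ?_ ?_)
    · unfold phase
      fun_prop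
    · refine Differentiable.differentiableAt (𝕜 := ℂ) (differentiable_finset_prod fun j _ => ?_)
      unfold divisorForm
      fun_prop
    · exact Finset.prod_ne_zero_iff.2 fun j hj => hpol u hu j (by simpa using hj)

/-! ### The end points of a segment of solutions -/

section Segment

variable {ι W : Type*} [AddCommGroup W] [Module ℝ W]

/-- The solutions lie on a line directed by `c`. Two points that both leave the orthant against `c`
must coincide, and `hreg` allows a point only one vanishing coordinate. -/
theorem exit_unique (L : (ι → ℝ) →ₗ[ℝ] W) {c : ι → ℝ}
    (hker : ∀ d, L d = 0 → ∃ s : ℝ, d = s • c)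
    {w : W} (hreg : ∀ p : ι → ℝ, (∀ i, 0 ≤ p i) → L p = w → ∀ k k', p k = 0 → p k' = 0 → k = k')
    {k k' : ι} (hk : 0 < c k) (hk' : 0 < c k') {p p' : ι → ℝ} (hp : ∀ i, 0 ≤ p i)
    (hp' : ∀ i, 0 ≤ p' i) (hL : L p = w) (hL' : L p' = w) (h0 : p k = 0) (h0' : p' k' = 0) :
    k = k' := by
  obtain ⟨s, hs⟩ := hker (p' - p) (by rw [map_sub, hL, hL', sub_self])
  have e1 := congrFun hs k
  have e2 := congrFun hs k'
  simp only [Pi.sub_apply, Pi.smul_apply, smul_eq_mul, h0, h0'] at e1 e2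
  have h1 : 0 ≤ s * c k := by linarith [hp' k]
  have h2 : s * c k' ≤ 0 := by linarith [hp k']
  have hs0 : s = 0 := le_antisymm (nonpos_of_mul_nonpos_left h2 hk') (nonneg_of_mul_nonneg_left h1 hk)
  rw [hs0, zero_mul] at e2
  exact hreg p hp hL k k' h0 (by linarith)

variable [Fintype ι]

/-- The ratio test of the simplex method: the smallest `p m / -c m` with `c m < 0` is the time at
which the ray from `p` along `c` leaves the orthant. -/
theorem exists_exit (L : (ι → ℝ) →ₗ[ℝ] W) {c : ι → ℝ} (hLc : L c = 0) {p : ι → ℝ}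
    (hp : ∀ i, 0 ≤ p i) (hneg : ∃ i, c i < 0) :
    ∃ k, c k < 0 ∧ ∃ p' : ι → ℝ, (∀ i, 0 ≤ p' i) ∧ L p' = L p ∧ p' k = 0 := by
  classical
  obtain ⟨i, hi⟩ := hneg
  obtain ⟨k, hk, hmin⟩ := Finset.exists_min_image (Finset.univ.filter fun m => c m < 0)
    (fun m => p m / -c m) ⟨i, by simpa using hi⟩
  simp only [Finset.mem_filter, Finset.mem_univ, true_and] at hk hmin
  have hs : 0 ≤ p k / -c k := div_nonneg (hp k) (by linarith)
  refine ⟨k, hk, p + (p k / -c k) • c, fun m => ?_, by simp [hLc], ?_⟩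
  · simp only [Pi.add_apply, Pi.smul_apply, smul_eq_mul]
    rcases le_or_gt 0 (c m) with h | h
    · have := mul_nonneg hs h
      linarith [hp m]
    · have h1 := (le_div_iff₀ (by linarith : 0 < -c m)).1 (hmin m h)
      linarith
  · simp only [Pi.add_apply, Pi.smul_apply, smul_eq_mul]
    have : c k ≠ 0 := hk.ne
    field_simp
    ring

open Classical in
/-- A bounded segment of solutions has one end point of each sign. -/
theorem sum_sign_exit (L : (ι → ℝ) →ₗ[ℝ] W) {c : ι → ℝ} (hLc : L c = 0)
    (hker : (∃ k, c k ≠ 0) → ∀ d, L d = 0 → ∃ s : ℝ, d = s • c)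
    {w : W} (hreg : ∀ p : ι → ℝ, (∀ i, 0 ≤ p i) → L p = w → ∀ k k', p k = 0 → p k' = 0 → k = k') :
    (∑ k with c k ≠ 0 ∧ ∃ p : ι → ℝ, (∀ i, 0 ≤ p i) ∧ L p = w ∧ p k = 0, SignType.sign (c k) : ℤ)
        = 0 ∨
      ∃ p d : ι → ℝ, (∀ i, 0 ≤ p i) ∧ L p = w ∧ (∀ i, 0 ≤ d i) ∧ d ≠ 0 ∧ L d = 0 := by
  rw [or_iff_not_imp_right]
  intro hno
  by_cases hV : ∃ k, c k ≠ 0 ∧ ∃ p : ι → ℝ, (∀ i, 0 ≤ p i) ∧ L p = w ∧ p k = 0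
  swap
  · rw [Finset.filter_false_of_mem fun k _ hk => hV ⟨k, hk⟩, Finset.sum_empty]
  obtain ⟨k₀, hk₀, p₀, hp₀, hL₀, -⟩ := hV
  -- If `c` or `-c` were nonnegative, it would be the direction of a ray of solutions.
  have hneg : ∃ i, c i < 0 := by
    by_contra! h
    exact hno ⟨p₀, c, hp₀, hL₀, h, fun h => hk₀ (congrFun h k₀), hLc⟩
  have hpos : ∃ i, (-c) i < 0 := by
    by_contra! h
    refine hno ⟨p₀, -c, hp₀, hL₀, h, fun h => hk₀ ?_, by rw [map_neg, hLc, neg_zero]⟩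
    simpa using congrFun h k₀
  replace hker := hker ⟨k₀, hk₀⟩
  have hker' : ∀ d, L d = 0 → ∃ s : ℝ, d = s • (-c) := fun d hd => by
    obtain ⟨s, hs⟩ := hker d hd
    exact ⟨-s, by simpa using hs⟩
  obtain ⟨k, hk, p, hp, hL, h0⟩ := exists_exit L hLc hp₀ hneg
  obtain ⟨k', hk', p', hp', hL', h0'⟩ := exists_exit L (by rw [map_neg, hLc, neg_zero]) hp₀ hpos
  have hk'' : 0 < c k' := by simpa using hk'
  have hne : k' ≠ k := by
    rintro rfl
    linarith
  have hset : (Finset.univ.filter fun k => c k ≠ 0 ∧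
      ∃ p : ι → ℝ, (∀ i, 0 ≤ p i) ∧ L p = w ∧ p k = 0) = {k', k} := by
    ext m
    simp only [Finset.mem_filter, Finset.mem_univ, true_and, Finset.mem_insert,
      Finset.mem_singleton]
    constructor
    · rintro ⟨hm, q, hq, hLq, hq0⟩
      rcases lt_or_gt_of_ne hm with h | h
      · exact Or.inr (exit_unique L hker' hreg (by simpa using h) (by simpa using hk) hq hp hLq
          (hL.trans hL₀) hq0 h0)
      · exact Or.inl (exit_unique L hker hreg h hk'' hq hp' hLq (hL'.trans hL₀) hq0 h0')
    · rintro (rfl | rfl)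
      · exact ⟨hk''.ne', p', hp', hL'.trans hL₀, h0'⟩
      · exact ⟨hk.ne, p, hp, hL.trans hL₀, h0⟩
  rw [hset, Finset.sum_pair hne, sign_pos hk'', sign_neg hk]
  rfl

end Segment

/-! ### Moment polytopes -/

section Polytope

variable {N r : ℕ} {Q : Matrix (Fin N) (Fin r) ℤ} {η : Fin r → ℝ}

theorem momentMap_sqrt {p : Fin N → ℝ} (hp : ∀ i, 0 ≤ p i) :
    momentMap Q (fun i => (Real.sqrt (p i) : ℂ)) = fun a => ∑ i, p i * Q i a := by
  funext a
  refine Finset.sum_congr rfl fun i _ => ?_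
  rw [Complex.norm_real, Real.norm_eq_abs, sq_abs, Real.sq_sqrt (hp i), mul_comm]

/-- The point with coordinates `√(p i)` lies in the fibre, which transfers regularity to the moment
polytope. -/
theorem span_charge_eq_top (hη : IsRegularValue Q η) {p : Fin N → ℝ} (hp : ∀ i, 0 ≤ p i)
    (h : ∀ a, ∑ i, p i * Q i a = η a) :
    Submodule.span ℝ (charge Q '' {i | p i ≠ 0}) = ⊤ := by
  have := hη (fun i => (Real.sqrt (p i) : ℂ)) ((momentMap_sqrt hp).trans (funext h))
  simpa [Real.sqrt_eq_zero (hp _)] using this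

/-- If the fibre of the moment polytope over `η` contains a ray on which the coordinates `I` and
`J` vanish, then `D_I ∩ D_J` is not compact. -/
theorem not_isCompact_of_ray {p d : Fin N → ℝ} (hp : ∀ i, 0 ≤ p i)
    (hpη : ∀ a, ∑ i, p i * Q i a = η a) (hd : ∀ i, 0 ≤ d i) (hd0 : d ≠ 0)
    (hdQ : ∀ a, ∑ i, d i * Q i a = 0) {I J : Fin N} (hpI : p I = 0) (hpJ : p J = 0)
    (hdI : d I = 0) (hdJ : d J = 0) :
    ¬ IsCompact (toricDivisor Q η I ∩ toricDivisor Q η J) := by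
  intro hcomp
  -- The squared norm is torus invariant, hence a continuous function on the quotient. It is
  -- unbounded along the ray; `s` below is chosen so that `s * d i₀` exceeds the supposed bound.
  let F : SymplecticQuotient Q η → ℝ := Quotient.lift (fun z : levelSet Q η => ∑ i, ‖z.1 i‖ ^ 2) (by
    rintro z w ⟨ϑ, h⟩
    refine Finset.sum_congr rfl fun i _ => ?_
    have : ‖Complex.exp (Complex.I * ∑ a, (Q i a : ℂ) * (ϑ a : ℂ))‖ = 1 := by
      rw [Complex.norm_exp]
      simp
    rw [h i, norm_mul, this, one_mul])
  have hF : Continuous F := by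
    refine Continuous.quotient_lift ?_ _
    exact continuous_finsetSum _ fun i _ =>
      ((continuous_apply i).comp continuous_subtype_val).norm.pow 2
  obtain ⟨C, hC⟩ := (hcomp.image hF).bddAbove
  obtain ⟨i₀, hi₀⟩ : ∃ i, d i ≠ 0 := by
    by_contra! h
    exact hd0 (funext h)
  have hi₀ : 0 < d i₀ := lt_of_le_of_ne (hd i₀) hi₀.symm
  let s : ℝ := (|C| + 1) / d i₀
  have hs : 0 ≤ s := by positivity
  have hq : ∀ i, 0 ≤ p i + s * d i := fun i => add_nonneg (hp i) (mul_nonneg hs (hd i))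
  let z : levelSet Q η := ⟨fun i => (Real.sqrt (p i + s * d i) : ℂ), by
    refine (momentMap_sqrt hq).trans (funext fun a => ?_)
    simp only [add_mul, Finset.sum_add_distrib, hpη, mul_assoc, ← Finset.mul_sum, hdQ, mul_zero,
      add_zero]⟩
  have hz : ∀ K, p K = 0 → d K = 0 → (Quotient.mk _ z : SymplecticQuotient Q η) ∈
      toricDivisor Q η K := fun K h1 h2 => ⟨z, by simp [z, h1, h2], rfl⟩
  have hle := hC ⟨_, ⟨hz I hpI hdI, hz J hpJ hdJ⟩, rfl⟩
  have hFz : F (Quotient.mk _ z) = ∑ i, (p i + s * d i) := by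
    refine Finset.sum_congr rfl fun i _ => ?_
    simp only [z]
    rw [Complex.norm_real, Real.norm_eq_abs, sq_abs, Real.sq_sqrt (hq i)]
  rw [hFz] at hle
  have h1 : p i₀ + s * d i₀ ≤ ∑ i, (p i + s * d i) :=
    Finset.single_le_sum (f := fun i => p i + s * d i) (fun i _ => hq i) (Finset.mem_univ i₀)
  have h2 : s * d i₀ = |C| + 1 := div_mul_cancel₀ _ hi₀.ne'
  linarith [hp i₀, le_abs_self C]

theorem sum_extend {M : ℕ} {τ : Fin M → Fin N} (hτ : Function.Injective τ) (p : Fin M → ℝ)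
    (a : Fin r) : ∑ i, Function.extend τ p 0 i * Q i a = ∑ k, p k * Q (τ k) a := by
  refine (Fintype.sum_of_injective τ hτ _ _ (fun i hi => ?_) fun k => ?_).symm
  · rw [Function.extend_apply' _ _ _ fun ⟨k, hk⟩ => hi ⟨k, hk⟩]
    simp
  · rw [hτ.extend_apply]

theorem extend_nonneg {M : ℕ} {τ : Fin M → Fin N} (hτ : Function.Injective τ) {p : Fin M → ℝ}
    (hp : ∀ k, 0 ≤ p k) (i : Fin N) : 0 ≤ Function.extend τ p 0 i := by
  by_cases h : ∃ k, τ k = i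
  · obtain ⟨k, rfl⟩ := h
    rw [hτ.extend_apply]
    exact hp k
  · rw [Function.extend_apply' _ _ _ h]
    rfl

/-- A solution supported on `r + 1` coordinates has at most one zero among them. -/
theorem zero_unique (hη : IsRegularValue Q η) {τ : Fin (r + 1) → Fin N}
    (hτ : Function.Injective τ) {p : Fin (r + 1) → ℝ} (hp : ∀ k, 0 ≤ p k)
    (h : ∀ a, ∑ k, p k * Q (τ k) a = η a) {k k' : Fin (r + 1)} (hk : p k = 0) (hk' : p k' = 0) :
    k = k' := by
  classical
  by_contra hne
  have hspan := span_charge_eq_top hη (extend_nonneg hτ hp) fun a => (sum_extend hτ p a).trans (h a)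
  let T : Finset (Fin r → ℝ) := ((Finset.univ.erase k).erase k').image fun m => charge Q (τ m)
  have hsub : charge Q '' {i | Function.extend τ p 0 i ≠ 0} ⊆ (T : Set (Fin r → ℝ)) := by
    rintro _ ⟨i, hi, rfl⟩
    have hi : Function.extend τ p 0 i ≠ 0 := hi
    by_cases hex : ∃ m, τ m = i
    · obtain ⟨m, rfl⟩ := hex
      rw [hτ.extend_apply] at hi
      refine Finset.mem_coe.2 (Finset.mem_image.2 ⟨m, ?_, rfl⟩)
      simp only [Finset.mem_erase, Finset.mem_univ, and_true]
      exact ⟨fun h => hi (h ▸ hk'), fun h => hi (h ▸ hk)⟩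
    · exact absurd (by rw [Function.extend_apply' _ _ _ hex]; rfl) hi
  have htop : Submodule.span ℝ (T : Set (Fin r → ℝ)) = ⊤ :=
    top_le_iff.1 (hspan ▸ Submodule.span_mono hsub)
  have h1 := finrank_span_finset_le_card (R := ℝ) T
  rw [Set.finrank, htop, finrank_top, Module.finrank_fin_fun] at h1
  have h2 : T.card ≤ ((Finset.univ.erase k).erase k').card := Finset.card_image_le
  rw [Finset.card_erase_of_mem (by simp [Ne.symm hne]), Finset.card_erase_of_mem (by simp),
    Finset.card_univ, Fintype.card_fin] at h2
  -- Two zeros leave at most `r - 1` charges to span `ℝ^r`. At `r = 0` truncated subtraction would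
  -- hide the contradiction, but then `Fin 1` has no two distinct indices.
  have : 0 < r := by
    rcases Nat.eq_zero_or_pos r with h0 | h0
    · subst h0
      exact absurd (Fin.ext (by omega)) hne
    · exact h0
  omega

end Polytope

/-! ### Circuits -/

section Circuit

variable {N r : ℕ} (Q : Matrix (Fin N) (Fin r) ℤ)

/-- The coefficients of the linear relation between `r + 1` charges, by Cramer's rule. -/
def circuitCoeff (τ : Fin (r + 1) → Fin N) (k : Fin (r + 1)) : ℤ :=
  (-1) ^ (k : ℕ) * (Matrix.of fun i a => Q (τ (k.succAbove i)) a : Matrix (Fin r) (Fin r) ℤ).det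

theorem sum_circuitCoeff_mul (τ : Fin (r + 1) → Fin N) (a : Fin r) :
    ∑ k, circuitCoeff Q τ k * Q (τ k) a = 0 := by
  -- The column `a` occurs twice, so the determinant vanishes; its expansion along the extra column
  -- is the relation.
  let M : Matrix (Fin (r + 1)) (Fin (r + 1)) ℤ :=
    Matrix.of fun k => Fin.cons (Q (τ k) a) fun b => Q (τ k) b
  have h0 : M.det = 0 := Matrix.det_zero_of_column_eq (Fin.succ_ne_zero a).symm fun k => by simp [M]
  rw [Matrix.det_succ_column_zero] at h0
  rw [← h0]
  refine Finset.sum_congr rfl fun k _ => ?_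
  have : M.submatrix k.succAbove Fin.succ =
      Matrix.of fun i a => Q (τ (k.succAbove i)) a := by
    ext i b
    simp [M]
  rw [this, circuitCoeff]
  simp only [M, Matrix.of_apply, Fin.cons_zero]
  ring

theorem det_chargeMinor (τ : Fin (r + 1) → Fin N) (k : Fin (r + 1)) :
    (chargeMinor Q (τ ∘ k.succAbove)).det = (-1) ^ (k : ℕ) * (circuitCoeff Q τ k : ℂ) := by
  have : chargeMinor Q (τ ∘ k.succAbove) =
      (Int.castRingHom ℂ).mapMatrix (Matrix.of fun i a => Q (τ (k.succAbove i)) a) := by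
    ext i a
    simp [chargeMinor]
  rw [this, ← RingHom.map_det, circuitCoeff, Int.cast_mul, Int.cast_pow, Int.cast_neg, Int.cast_one,
    ← mul_assoc, ← mul_pow, neg_mul_neg, one_mul, one_pow, one_mul]
  rfl

theorem det_chargeMinor_ne_zero_iff (τ : Fin (r + 1) → Fin N) (k : Fin (r + 1)) :
    (chargeMinor Q (τ ∘ k.succAbove)).det ≠ 0 ↔ circuitCoeff Q τ k ≠ 0 := by
  rw [det_chargeMinor]
  simp

theorem norm_det_chargeMinor (τ : Fin (r + 1) → Fin N) (k : Fin (r + 1)) :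
    ‖(chargeMinor Q (τ ∘ k.succAbove)).det‖ = |(circuitCoeff Q τ k : ℝ)| := by
  rw [det_chargeMinor, norm_mul, norm_pow, norm_neg, norm_one, one_pow, one_mul,
    Complex.norm_intCast]

/-- In the `c`-weighted sum of the `r + 1` forms the `φ`-dependence cancels, and at the vertex only
the `k`-th form survives. So the polar hyperplane in `ε`-space depends only on `τ`, not on the
omitted `k`. -/
theorem circuitCoeff_mul_vertexForm {τ : Fin (r + 1) → Fin N} {k : Fin (r + 1)}
    (hk : circuitCoeff Q τ k ≠ 0) (ε : Fin N → ℂ) :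
    (circuitCoeff Q τ k : ℂ) * vertexForm Q (τ ∘ k.succAbove) (τ k) ε =
      ∑ m, (circuitCoeff Q τ m : ℂ) * ε (τ m) := by
  have hdet := (det_chargeMinor_ne_zero_iff Q τ k).2 hk
  set φ := vertex Q (τ ∘ k.succAbove) ε with hφ
  have h1 : ∑ m, (circuitCoeff Q τ m : ℂ) * divisorForm Q ε (τ m) φ =
      ∑ m, (circuitCoeff Q τ m : ℂ) * ε (τ m) := by
    simp only [divisorForm, mul_add, Finset.sum_add_distrib, Finset.mul_sum, add_eq_left]
    rw [Finset.sum_comm]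
    refine Finset.sum_eq_zero fun a _ => ?_
    have := congrArg (fun n : ℤ => (n : ℂ)) (sum_circuitCoeff_mul Q τ a)
    simp only [Int.cast_sum, Int.cast_mul, Int.cast_zero] at this
    simp only [← mul_assoc, ← Finset.sum_mul, this, zero_mul]
  rw [← h1, Fin.sum_univ_succAbove _ k, vertexForm_apply, left_eq_add]
  refine Finset.sum_eq_zero fun i _ => ?_
  have := divisorForm_localPoint Q ε hdet 0 i
  rw [Function.comp_apply, ← vertex_apply, ← hφ] at this
  rw [this]
  simp

theorem divisorForm_vertex_of_circuit {τ : Fin (r + 1) → Fin N} {k : Fin (r + 1)}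
    (hk : circuitCoeff Q τ k ≠ 0) {ε : Fin N → ℂ}
    (hε : ∑ m, (circuitCoeff Q τ m : ℂ) * ε (τ m) = 0) (m : Fin (r + 1)) :
    divisorForm Q ε (τ m) (vertex Q (τ ∘ k.succAbove) ε) = 0 := by
  have hdet := (det_chargeMinor_ne_zero_iff Q τ k).2 hk
  refine Fin.succAboveCases k ?_ (fun i => ?_) m
  · have := circuitCoeff_mul_vertexForm Q hk ε
    rw [hε, vertexForm_apply] at this
    exact (mul_eq_zero.1 this).resolve_left (by exact_mod_cast hk)
  · exact divisorForm_localPoint Q ε hdet 0 i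

theorem vertex_eq_of_circuit {τ : Fin (r + 1) → Fin N} {k k' : Fin (r + 1)}
    (hk : circuitCoeff Q τ k ≠ 0) (hk' : circuitCoeff Q τ k' ≠ 0) {ε : Fin N → ℂ}
    (hε : ∑ m, (circuitCoeff Q τ m : ℂ) * ε (τ m) = 0) :
    vertex Q (τ ∘ k.succAbove) ε = vertex Q (τ ∘ k'.succAbove) ε :=
  eq_localPoint Q ε ((det_chargeMinor_ne_zero_iff Q τ k').2 hk')
    fun i => divisorForm_vertex_of_circuit Q hk hε (k'.succAbove i)

/-- The linear map `p ↦ ∑_k p_k Q_{τ k}`. -/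
def circuitMap (τ : Fin (r + 1) → Fin N) : (Fin (r + 1) → ℝ) →ₗ[ℝ] (Fin r → ℝ) :=
  (Matrix.of fun k a => (Q (τ k) a : ℝ) : Matrix (Fin (r + 1)) (Fin r) ℝ).vecMulLinear

theorem circuitMap_apply (τ : Fin (r + 1) → Fin N) (p : Fin (r + 1) → ℝ) (a : Fin r) :
    circuitMap Q τ p a = ∑ k, p k * Q (τ k) a := by
  simp [circuitMap, Matrix.vecMul, dotProduct]

theorem circuitMap_circuitCoeff (τ : Fin (r + 1) → Fin N) :
    circuitMap Q τ (fun k => (circuitCoeff Q τ k : ℝ)) = 0 := by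
  funext a
  rw [circuitMap_apply]
  have := congrArg (fun n : ℤ => (n : ℝ)) (sum_circuitCoeff_mul Q τ a)
  simpa using this

theorem ker_circuitMap {τ : Fin (r + 1) → Fin N} {k : Fin (r + 1)}
    (hk : (circuitCoeff Q τ k : ℝ) ≠ 0) {d : Fin (r + 1) → ℝ} (hd : circuitMap Q τ d = 0) :
    ∃ s : ℝ, d = s • fun k => (circuitCoeff Q τ k : ℝ) := by
  refine ⟨d k / circuitCoeff Q τ k, ?_⟩
  set c : Fin (r + 1) → ℝ := fun k => (circuitCoeff Q τ k : ℝ) with hc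
  -- Subtracting this multiple of the relation kills the coordinate `k`; the other `r` charges are
  -- independent because their minor is `± c k`.
  set d' := d - (d k / circuitCoeff Q τ k) • c with hd'
  have h0 : d' k = 0 := by simp [hd', hc, hk]
  have hL : circuitMap Q τ d' = 0 := by
    rw [hd', map_sub, map_smul, hd, circuitMap_circuitCoeff]
    simp
  let M : Matrix (Fin r) (Fin r) ℝ := Matrix.of fun i a => (Q (τ (k.succAbove i)) a : ℝ)
  have hM : M.det ≠ 0 := by
    have : M = (Int.castRingHom ℝ).mapMatrix (Matrix.of fun i a => Q (τ (k.succAbove i)) a) := by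
      ext i a
      simp [M]
    rw [this, ← RingHom.map_det]
    intro h
    apply hk
    rw [circuitCoeff, Int.cast_mul]
    simp only [eq_intCast] at h
    rw [h, mul_zero]
  have hv : Matrix.vecMul (fun i => d' (k.succAbove i)) M = 0 := by
    funext a
    have := congrFun hL a
    rw [circuitMap_apply, Fin.sum_univ_succAbove _ k, h0, zero_mul, zero_add] at this
    simpa [Matrix.vecMul, dotProduct, M] using this
  have hz := Matrix.eq_zero_of_vecMul_eq_zero hM hv
  have : d' = 0 := by
    funext m
    refine Fin.succAboveCases k h0 (fun i => ?_) m
    exact congrFun hz i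
  exact sub_eq_zero.1 this

/-- This turns the Jeffrey–Kirwan condition into the end-point condition of `sum_sign_exit`: `η`
lies in the cone without `τ k` exactly when some solution on `τ` vanishes at `k`. -/
theorem isJKPole_comp_succAbove (η : Fin r → ℝ) {τ : Fin (r + 1) → Fin N} (hτ : StrictMono τ)
    (k : Fin (r + 1)) :
    IsJKPole Q η (τ ∘ k.succAbove) ↔ (circuitCoeff Q τ k : ℝ) ≠ 0 ∧
      ∃ p : Fin (r + 1) → ℝ, (∀ i, 0 ≤ p i) ∧ circuitMap Q τ p = η ∧ p k = 0 := by
  have hmono : StrictMono (τ ∘ k.succAbove) := hτ.comp k.strictMono_succAbove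
  rw [IsJKPole, det_chargeMinor_ne_zero_iff, Int.cast_ne_zero]
  refine ⟨fun ⟨_, hc, p, hp, hpη⟩ => ⟨hc, k.insertNth 0 p, ?_, ?_, by simp⟩,
    fun ⟨hc, p, hp, hpη, h0⟩ => ⟨hmono, hc, fun i => p (k.succAbove i), fun i => hp _, fun a => ?_⟩⟩
  · intro m
    refine Fin.succAboveCases k ?_ (fun i => ?_) m
    · simp
    · simpa using hp i
  · funext a
    rw [circuitMap_apply, Fin.sum_univ_succAbove _ k, ← hpη a]
    simp [mul_comm]
  · rw [← hpη, circuitMap_apply, Fin.sum_univ_succAbove _ k, h0, zero_mul, zero_add]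
    simp [mul_comm]

theorem range_eq_insert (τ : Fin (r + 1) → Fin N) (k : Fin (r + 1)) :
    Set.range τ = insert (τ k) (Set.range (τ ∘ k.succAbove)) := by
  ext i
  simp only [Set.mem_range, Set.mem_insert_iff, Function.comp_apply]
  constructor
  · rintro ⟨m, rfl⟩
    refine Fin.succAboveCases k (Or.inl rfl) (fun i => Or.inr ⟨i, rfl⟩) m
  · rintro (rfl | ⟨m, rfl⟩)
    · exact ⟨k, rfl⟩
    · exact ⟨_, rfl⟩

theorem notMem_range_comp_succAbove {τ : Fin (r + 1) → Fin N} (hτ : Function.Injective τ)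
    (k : Fin (r + 1)) : τ k ∉ Set.range (τ ∘ k.succAbove) := by
  rintro ⟨i, hi⟩
  exact k.succAbove_ne i (hτ hi)

open Classical in
/-- Pairs of an `r`-element set and a further element, grouped by their union. -/
theorem sum_strictMono_compl (g : (Fin r → Fin N) → Fin N → ℂ) :
    ∑ σ : Fin r → Fin N with StrictMono σ, ∑ j ∈ (Finset.univ.image σ)ᶜ, g σ j =
      ∑ τ : Fin (r + 1) → Fin N with StrictMono τ, ∑ k, g (τ ∘ k.succAbove) (τ k) := by
  rw [Finset.sum_sigma', Finset.sum_sigma']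
  symm
  refine Finset.sum_bij (fun x _ => ⟨x.1 ∘ x.2.succAbove, x.1 x.2⟩) ?_ ?_ ?_ fun _ _ => rfl
  · rintro ⟨τ, k⟩ h
    have hτ : StrictMono τ := by simpa using h
    have := notMem_range_comp_succAbove hτ.injective k
    simpa [hτ.comp k.strictMono_succAbove] using this
  · rintro ⟨τ, k⟩ h ⟨τ', k'⟩ h' heq
    have hτ : StrictMono τ := by simpa using h
    have hτ' : StrictMono τ' := by simpa using h'
    simp only [Sigma.mk.injEq, heq_eq_eq] at heq
    have hr : τ = τ' := by
      rw [← hτ.range_inj hτ', range_eq_insert τ k, range_eq_insert τ' k', heq.1, heq.2]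
    subst hr
    rw [hτ.injective heq.2]
  · rintro ⟨σ, j⟩ h
    simp only [Finset.mem_sigma, Finset.mem_filter, Finset.mem_univ, true_and, Finset.mem_compl,
      Finset.mem_image, not_exists] at h
    obtain ⟨hσ, hj⟩ := h
    have hj' : j ∉ Finset.univ.image σ := by simpa using hj
    have hcard : (insert j (Finset.univ.image σ)).card = r + 1 := by
      rw [Finset.card_insert_of_notMem hj', Finset.card_image_of_injective _ hσ.injective]
      simp
    let τ := (insert j (Finset.univ.image σ)).orderEmbOfFin hcard
    have hrange : Set.range τ = insert j (Set.range σ) := by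
      rw [Finset.range_orderEmbOfFin]
      simp
    obtain ⟨k, hk⟩ : j ∈ Set.range τ := hrange ▸ Set.mem_insert _ _
    refine ⟨⟨τ, k⟩, by simpa using τ.strictMono, ?_⟩
    have hσ' : τ ∘ k.succAbove = σ := by
      rw [← (τ.strictMono.comp k.strictMono_succAbove).range_inj hσ]
      have h1 := range_eq_insert τ k
      rw [hrange, hk] at h1
      have h2 := notMem_range_comp_succAbove τ.injective k
      rw [hk] at h2
      have h3 : j ∉ Set.range σ := by simpa using hj
      ext i
      have h4 := Set.ext_iff.1 h1 i
      simp only [Set.mem_insert_iff] at h4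
      by_cases hij : i = j
      · subst hij
        exact iff_of_false h2 h3
      · simpa [hij] using h4.symm
    simp [hσ', hk]

end Circuit

variable {N r : ℕ} {Q : Matrix (Fin N) (Fin r) ℤ} {η : Fin r → ℝ}

/-! ### The difference as a sum over the Jeffrey–Kirwan poles -/

/-- `∑ m^{IJ} (ε_I + Q_I^a φ_a) (ε_J + Q_J^a φ_a)`. -/
def pairSum (m : CompactPair Q η → ℂ) (ε : Fin N → ℂ) (φ : Fin r → ℂ) : ℂ :=
  ∑ p, m p * divisorForm Q ε p.1.1 φ * divisorForm Q ε p.1.2 φ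

/-- The three shifts are the constant, linear and quadratic parts in `φ` of `pairSum`. -/
theorem quadShift_add_phase (m : CompactPair Q η → ℂ) (ε : Fin N → ℂ) (t : Fin r → ℂ)
    (t₂ : Fin r → Fin r → ℂ) (φ : Fin r → ℂ) :
    quadShift ε m + phase (t + psiOne ε m) (t₂ + psiTwo m) φ = phase t t₂ φ + pairSum m ε φ := by
  have h1 : ∑ a, psiOne ε m a * φ a = ∑ p : CompactPair Q η,
      m p * (ε p.1.2 * ∑ a, (Q p.1.1 a : ℂ) * φ a + ε p.1.1 * ∑ a, (Q p.1.2 a : ℂ) * φ a) := by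
    simp only [psiOne, Finset.sum_mul, Finset.mul_sum, ← Finset.sum_add_distrib]
    rw [Finset.sum_comm]
    exact Finset.sum_congr rfl fun p _ => Finset.sum_congr rfl fun a _ => by ring
  have h2 : ∑ a, ∑ b, psiTwo m a b * φ a * φ b = ∑ p : CompactPair Q η,
      m p * ((∑ a, (Q p.1.1 a : ℂ) * φ a) * ∑ a, (Q p.1.2 a : ℂ) * φ a) := by
    simp only [psiTwo, Finset.sum_mul, Finset.mul_sum]
    rw [Finset.sum_comm' (t' := Finset.univ) (s' := fun _ => Finset.univ) (by simp)]
    rw [Finset.sum_comm]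
    simp only [Finset.sum_comm (s := (Finset.univ : Finset (Fin r)))
      (t := (Finset.univ : Finset (CompactPair Q η)))]
    refine Finset.sum_congr rfl fun p _ => ?_
    rw [Finset.sum_comm]
    exact Finset.sum_congr rfl fun a _ => Finset.sum_congr rfl fun b _ => by ring
  have h3 : pairSum m ε φ = quadShift ε m + ∑ a, psiOne ε m a * φ a +
      ∑ a, ∑ b, psiTwo m a b * φ a * φ b := by
    rw [h1, h2, pairSum, quadShift, ← Finset.sum_add_distrib, ← Finset.sum_add_distrib]
    refine Finset.sum_congr rfl fun p _ => ?_
    simp only [divisorForm]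
    ring
  rw [h3]
  simp only [phase, Pi.add_apply, add_mul, Finset.sum_add_distrib]
  ring

/-- The numerator of the contribution of the pole `σ` to the difference. -/
def poleNumerator (t : Fin r → ℂ) (t₂ : Fin r → Fin r → ℂ) (m : CompactPair Q η → ℂ)
    (σ : Fin r → Fin N) (ε : Fin N → ℂ) : ℂ :=
  (‖(chargeMinor Q σ).det‖ : ℂ)⁻¹ * (Complex.exp (phase t t₂ (vertex Q σ ε)) -
    Complex.exp (phase t t₂ (vertex Q σ ε) + pairSum m ε (vertex Q σ ε)))

theorem differentiable_poleNumerator (t : Fin r → ℂ) (t₂ : Fin r → Fin r → ℂ)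
    (m : CompactPair Q η → ℂ) (σ : Fin r → Fin N) :
    Differentiable ℂ (poleNumerator t t₂ m σ) := by
  unfold poleNumerator phase pairSum divisorForm
  fun_prop

open Classical in
theorem generatingFunction_sub (t : Fin r → ℂ) (t₂ : Fin r → Fin r → ℂ)
    (m : CompactPair Q η → ℂ) {ε : Fin N → ℂ}
    (hε : ∀ σ, IsJKPole Q η σ → ∀ j ∉ Set.range σ, vertexForm Q σ j ε ≠ 0) :
    generatingFunction Q η ε t t₂ - Complex.exp (quadShift ε m) *
        generatingFunction Q η ε (t + psiOne ε m) (t₂ + psiTwo m) =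
      ∑ σ : {σ // IsJKPole Q η σ}, poleNumerator t t₂ m σ.1 ε /
        ∏ j ∈ (Finset.univ.image σ.1)ᶜ, vertexForm Q σ.1 j ε := by
  rw [generatingFunction, generatingFunction, Finset.mul_sum, ← Finset.sum_sub_distrib,
    Finset.sum_subtype (p := IsJKPole Q η) _ (by simp)]
  refine Finset.sum_congr rfl fun σ _ => ?_
  rw [torusResidue_integrand Q σ.2.1.injective σ.2.2.1 (hε _ σ.2),
    torusResidue_integrand Q σ.2.1.injective σ.2.2.1 (hε _ σ.2), poleNumerator,
    ← quadShift_add_phase, Complex.exp_add]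
  ring

-- On the hyperplane of the circuit all vertices in `τ` coincide, so the selected residues differ
-- only by the sign of `c k`. They cancel in the bounded case, and each vanishes in the unbounded
-- one.
open Classical in
theorem sum_residue_circuit (hη : IsRegularValue Q η) (t : Fin r → ℂ) (t₂ : Fin r → Fin r → ℂ)
    (m : CompactPair Q η → ℂ) {τ : Fin (r + 1) → Fin N} (hτ : StrictMono τ) (e v : Fin N → ℂ) :
    ∑ k : Fin (r + 1), (if IsJKPole Q η (τ ∘ k.succAbove) ∧
        vertexForm Q (τ ∘ k.succAbove) (τ k) e = 0 then
      poleNumerator t t₂ m (τ ∘ k.succAbove) e / (vertexForm Q (τ ∘ k.succAbove) (τ k) v *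
        ∏ j ∈ (Finset.univ.image (τ ∘ k.succAbove))ᶜ.erase (τ k),
          vertexForm Q (τ ∘ k.succAbove) j e) else 0) = 0 := by
  by_cases hℓ : ∑ i, (circuitCoeff Q τ i : ℂ) * e (τ i) = 0
  swap
  · refine Finset.sum_eq_zero fun k _ => if_neg fun ⟨h, h0⟩ => hℓ ?_
    have hk : circuitCoeff Q τ k ≠ 0 := (det_chargeMinor_ne_zero_iff Q τ k).1 h.2.1
    rw [← circuitCoeff_mul_vertexForm Q hk, h0, mul_zero]
  by_cases hex : ∃ k, circuitCoeff Q τ k ≠ 0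
  swap
  · refine Finset.sum_eq_zero fun k _ => if_neg fun ⟨h, h0⟩ => hex ⟨k, ?_⟩
    exact (det_chargeMinor_ne_zero_iff Q τ k).1 h.2.1
  obtain ⟨k₀, hk₀⟩ := hex
  set φ := vertex Q (τ ∘ k₀.succAbove) e with hφ
  set K : ℂ := Complex.exp (phase t t₂ φ) - Complex.exp (phase t t₂ φ + pairSum m e φ) with hK
  -- The common residue up to sign: `1 / |c k|` from the Jacobian times `c k` from the transversal
  -- derivative leaves `sign (c k)`.
  set W : ℂ := K / ((∑ i, (circuitCoeff Q τ i : ℂ) * v (τ i)) *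
    ∏ j ∈ (Finset.univ.image τ)ᶜ, divisorForm Q e j φ) with hW
  have hset : ∀ k : Fin (r + 1), (Finset.univ.image (τ ∘ k.succAbove))ᶜ.erase (τ k) =
      (Finset.univ.image τ)ᶜ := by
    intro k
    ext j
    have := Set.ext_iff.1 (range_eq_insert τ k) j
    simp only [Set.mem_range, Set.mem_insert_iff] at this
    simp only [Finset.mem_erase, Finset.mem_compl, Finset.mem_image, Finset.mem_univ, true_and,
      this, not_or]
  have hterm : ∀ k, circuitCoeff Q τ k ≠ 0 →
      poleNumerator t t₂ m (τ ∘ k.succAbove) e / (vertexForm Q (τ ∘ k.succAbove) (τ k) v *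
        ∏ j ∈ (Finset.univ.image (τ ∘ k.succAbove))ᶜ.erase (τ k),
          vertexForm Q (τ ∘ k.succAbove) j e) =
      ((SignType.sign (circuitCoeff Q τ k : ℝ) : ℤ) : ℂ) * W := by
    intro k hk
    have hc : (circuitCoeff Q τ k : ℂ) ≠ 0 := by exact_mod_cast hk
    have hφk : vertex Q (τ ∘ k.succAbove) e = φ := vertex_eq_of_circuit Q hk hk₀ hℓ
    simp only [hset, vertexForm_apply Q _ _ e, hφk, poleNumerator]
    rw [hW, ← circuitCoeff_mul_vertexForm Q hk, norm_det_chargeMinor]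
    have hsign : ((|(circuitCoeff Q τ k : ℝ)| : ℝ) : ℂ)⁻¹ =
        ((SignType.sign (circuitCoeff Q τ k : ℝ) : ℤ) : ℂ) * (circuitCoeff Q τ k : ℂ)⁻¹ := by
      have hr : (circuitCoeff Q τ k : ℝ) ≠ 0 := by exact_mod_cast hk
      rcases lt_or_gt_of_ne hr with h | h
      · rw [sign_neg h, abs_of_neg h]
        push_cast
        simp [inv_neg]
      · rw [sign_pos h, abs_of_pos h]
        push_cast
        simp
    rw [hsign, ← hK]
    simp only [div_eq_mul_inv, mul_inv]
    ring
  have hsum : ∑ k : Fin (r + 1), (if IsJKPole Q η (τ ∘ k.succAbove) ∧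
        vertexForm Q (τ ∘ k.succAbove) (τ k) e = 0 then
      poleNumerator t t₂ m (τ ∘ k.succAbove) e / (vertexForm Q (τ ∘ k.succAbove) (τ k) v *
        ∏ j ∈ (Finset.univ.image (τ ∘ k.succAbove))ᶜ.erase (τ k),
          vertexForm Q (τ ∘ k.succAbove) j e) else 0) =
      ((∑ k with (circuitCoeff Q τ k : ℝ) ≠ 0 ∧ ∃ p : Fin (r + 1) → ℝ, (∀ i, 0 ≤ p i) ∧
        circuitMap Q τ p = η ∧ p k = 0, SignType.sign (circuitCoeff Q τ k : ℝ) : ℤ) : ℂ) * W := by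
    rw [Int.cast_sum, Finset.sum_mul, Finset.sum_filter]
    refine Finset.sum_congr rfl fun k _ => ?_
    simp only [← isJKPole_comp_succAbove Q η hτ k]
    by_cases h : IsJKPole Q η (τ ∘ k.succAbove)
    · have hk : circuitCoeff Q τ k ≠ 0 := (det_chargeMinor_ne_zero_iff Q τ k).1 h.2.1
      have h0 : vertexForm Q (τ ∘ k.succAbove) (τ k) e = 0 := by
        rw [vertexForm_apply]
        exact divisorForm_vertex_of_circuit Q hk hℓ k
      rw [if_pos ⟨h, h0⟩, if_pos h, hterm k hk]
    · rw [if_neg fun h' => h h'.1, if_neg h]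
  rw [hsum]
  rcases sum_sign_exit (circuitMap Q τ) (circuitMap_circuitCoeff Q τ)
    (fun ⟨k, hk⟩ d hd => ker_circuitMap Q hk hd) (w := η) (fun p hp hpη k k' h h' =>
      zero_unique hη hτ.injective hp (fun a => by rw [← circuitMap_apply, hpη]) h h')
    with h | ⟨p, d, hp, hpη, hd, hd0, hdQ⟩
  · rw [h]
    simp
  -- Compactness of `D_I ∩ D_J` enters only here: extended by zero off `τ`, the ray would lie in
  -- `D_I ∩ D_J` if neither index were in `τ`.
  · have hpair : pairSum m e φ = 0 := by
      refine Finset.sum_eq_zero fun q _ => ?_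
      have hvan : ∀ I ∈ Set.range τ, divisorForm Q e I φ = 0 := by
        rintro _ ⟨k, rfl⟩
        exact divisorForm_vertex_of_circuit Q hk₀ hℓ k
      by_cases hI : q.1.1 ∈ Set.range τ
      · rw [hvan _ hI]
        ring
      by_cases hJ : q.1.2 ∈ Set.range τ
      · rw [hvan _ hJ]
        ring
      have hz : ∀ (f : Fin (r + 1) → ℝ) I, I ∉ Set.range τ → Function.extend τ f 0 I = 0 :=
        fun f I hI => Function.extend_apply' _ _ _ hI
      refine absurd q.2 (not_isCompact_of_ray (extend_nonneg hτ.injective hp)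
        (fun a => ?_) (extend_nonneg hτ.injective hd) (fun h => hd0 ?_) (fun a => ?_)
        (hz p _ hI) (hz p _ hJ) (hz d _ hI) (hz d _ hJ))
      · rw [sum_extend hτ.injective, ← circuitMap_apply, hpη]
      · funext k
        have := congrFun h (τ k)
        rwa [hτ.injective.extend_apply] at this
      · rw [sum_extend hτ.injective, ← circuitMap_apply, hdQ]
        rfl
    have : W = 0 := by
      rw [hW, hK, hpair]
      simp
    rw [this, mul_zero]

open Classical in
theorem exists_entire_difference (hη : IsRegularValue Q η) (t : Fin r → ℂ)
    (t₂ : Fin r → Fin r → ℂ) (m : CompactPair Q η → ℂ) :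
    ∃ R : (Fin N → ℂ) → ℂ, Differentiable ℂ R ∧ ∀ ε,
      (∀ σ : {σ // IsJKPole Q η σ}, ∀ j ∈ (Finset.univ.image σ.1)ᶜ, vertexForm Q σ.1 j ε ≠ 0) →
      R ε = ∑ σ : {σ // IsJKPole Q η σ}, poleNumerator t t₂ m σ.1 ε /
        ∏ j ∈ (Finset.univ.image σ.1)ᶜ, vertexForm Q σ.1 j ε := by
  have hrange : ∀ (σ : Fin r → Fin N) j, j ∈ (Finset.univ.image σ)ᶜ → j ∉ Set.range σ := by
    intro σ j hj
    simpa using hj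
  refine exists_entire_of_residues (fun σ : {σ // IsJKPole Q η σ} => (Finset.univ.image σ.1)ᶜ)
    (fun σ j => vertexForm Q σ.1 j) (fun σ j hj h => ?_) (fun σ => poleNumerator t t₂ m σ.1)
    (fun σ => differentiable_poleNumerator t t₂ m σ.1) (fun σ j hj j' hj' hne h => ?_)
    fun σ₀ j₀ _ e v _ _ _ => ?_
  · have := vertexForm_single Q (j := j) (hrange _ _ hj)
    rw [h] at this
    simp at this
  · have h1 := h (Pi.single j' 1) (by
      rw [vertexForm_single Q (hrange _ _ hj'), if_neg hne])
    rw [vertexForm_single Q (hrange _ _ hj'), if_pos rfl] at h1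
    exact one_ne_zero h1
  -- Extending the residues by zero to all increasing lists `σ` allows the pairs `(σ, j)` to be
  -- regrouped by their union `τ`.
  · let g : (Fin r → Fin N) → Fin N → ℂ := fun σ j =>
      if IsJKPole Q η σ ∧ vertexForm Q σ j e = 0 then
        poleNumerator t t₂ m σ e / (vertexForm Q σ j v *
          ∏ j' ∈ (Finset.univ.image σ)ᶜ.erase j, vertexForm Q σ j' e) else 0
    have hg : ∑ σ : Fin r → Fin N with StrictMono σ, ∑ j ∈ (Finset.univ.image σ)ᶜ, g σ j = 0 := by
      rw [sum_strictMono_compl]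
      exact Finset.sum_eq_zero fun τ hτ =>
        sum_residue_circuit hη t t₂ m (by simpa using hτ) e v
    refine Eq.trans ?_ hg
    have hsub : ∑ σ : Fin r → Fin N with StrictMono σ, ∑ j ∈ (Finset.univ.image σ)ᶜ, g σ j =
        ∑ σ : Fin r → Fin N with IsJKPole Q η σ, ∑ j ∈ (Finset.univ.image σ)ᶜ, g σ j := by
      symm
      refine Finset.sum_subset (fun σ hσ => ?_) fun σ _ hσ => ?_
      · simp only [Finset.mem_filter, Finset.mem_univ, true_and] at hσ ⊢
        exact hσ.1
      · refine Finset.sum_eq_zero fun j _ => if_neg fun h => hσ ?_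
        simpa using h.1
    rw [hsub, Finset.sum_subtype (p := IsJKPole Q η) _ (by simp)]
    refine Finset.sum_congr rfl fun σ _ => ?_
    rw [Finset.sum_filter]
    refine Finset.sum_congr rfl fun j _ => ?_
    simp only [g, σ.2, true_and]

/-! ### The value at `ε = 0` -/

/-- The prefactor has coefficients in `MvPolynomial X ℂ`, so one `p` serves for all `x`; this makes
the Taylor coefficients polynomial in the times. -/
theorem iteratedDeriv_exp_quadratic {X : Type*} (a b : MvPolynomial X ℂ) (n : ℕ) :
    ∃ p : Polynomial (MvPolynomial X ℂ), ∀ (x : X → ℂ) (s : ℂ),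
      iteratedDeriv n (fun s => Complex.exp (s * MvPolynomial.eval x a +
        s ^ 2 * MvPolynomial.eval x b)) s = (p.map (MvPolynomial.eval x)).eval s *
          Complex.exp (s * MvPolynomial.eval x a + s ^ 2 * MvPolynomial.eval x b) := by
  induction n with
  | zero => exact ⟨1, by simp⟩
  | succ n ih =>
    obtain ⟨p, hp⟩ := ih
    refine ⟨Polynomial.derivative p + p * (Polynomial.C a + Polynomial.C (b + b) * Polynomial.X),
      fun x s => ?_⟩
    rw [iteratedDeriv_succ, funext (hp x)]
    have h1 : HasDerivAt (fun s => s * MvPolynomial.eval x a + s ^ 2 * MvPolynomial.eval x b)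
        (1 * MvPolynomial.eval x a + (2 : ℕ) * s ^ (2 - 1) * MvPolynomial.eval x b) s :=
      ((hasDerivAt_id s).mul_const _).add ((hasDerivAt_pow 2 s).mul_const _)
    have h2 := ((p.map (MvPolynomial.eval x)).hasDerivAt s).fun_mul h1.cexp
    rw [h2.deriv]
    simp only [Polynomial.derivative_map, Polynomial.map_add, Polynomial.map_mul,
      Polynomial.map_C, Polynomial.map_X, Polynomial.eval_add, Polynomial.eval_mul,
      Polynomial.eval_C, Polynomial.eval_X, map_add]
    push_cast
    ring

theorem exists_iteratedDeriv_exp_eq_eval {X : Type*} (a b : MvPolynomial X ℂ) (n : ℕ) :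
    ∃ p : MvPolynomial X ℂ, ∀ x : X → ℂ,
      iteratedDeriv n (fun s => Complex.exp (s * MvPolynomial.eval x a +
        s ^ 2 * MvPolynomial.eval x b)) 0 = MvPolynomial.eval x p := by
  obtain ⟨p, hp⟩ := iteratedDeriv_exp_quadratic a b n
  refine ⟨p.eval 0, fun x => ?_⟩
  rw [hp]
  simp [← Polynomial.coeff_zero_eq_eval_zero]

theorem iteratedDeriv_pow_mul_zero {f : ℂ → ℂ} (hf : Differentiable ℂ f) (d : ℕ) :
    iteratedDeriv d (fun s => s ^ d * f s) 0 = d.factorial * f 0 := by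
  rw [iteratedDeriv_fun_mul (by fun_prop) hf.contDiff.contDiffAt,
    Finset.sum_eq_single d]
  · rw [iteratedDeriv_fun_pow_zero, if_pos rfl]
    simp
  · intro i _ hi
    rw [iteratedDeriv_fun_pow_zero, if_neg hi]
    simp
  · simp

/-- The polynomial `∑_a t^a φ_a` in the variables `(t, t⁽²⁾, m)`. -/
def linearPhase (Q : Matrix (Fin N) (Fin r) ℤ) (η : Fin r → ℝ) (φ : Fin r → ℂ) :
    MvPolynomial (Fin r ⊕ (Fin r × Fin r) ⊕ CompactPair Q η) ℂ :=
  ∑ a, MvPolynomial.X (Sum.inl a) * MvPolynomial.C (φ a)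

/-- The polynomial `∑_{a,b} t^{ab} φ_a φ_b` in the variables `(t, t⁽²⁾, m)`. -/
def quadraticPhase (Q : Matrix (Fin N) (Fin r) ℤ) (η : Fin r → ℝ) (φ : Fin r → ℂ) :
    MvPolynomial (Fin r ⊕ (Fin r × Fin r) ⊕ CompactPair Q η) ℂ :=
  ∑ a, ∑ b, MvPolynomial.X (Sum.inr (Sum.inl (a, b))) * MvPolynomial.C (φ a) * MvPolynomial.C (φ b)

/-- `pairSum` as a polynomial in the variables `(t, t⁽²⁾, m)`. -/
def pairPolynomial (Q : Matrix (Fin N) (Fin r) ℤ) (η : Fin r → ℝ) (ε : Fin N → ℂ)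
    (φ : Fin r → ℂ) : MvPolynomial (Fin r ⊕ (Fin r × Fin r) ⊕ CompactPair Q η) ℂ :=
  ∑ p : CompactPair Q η, MvPolynomial.X (Sum.inr (Sum.inr p)) *
    MvPolynomial.C (divisorForm Q ε p.1.1 φ) * MvPolynomial.C (divisorForm Q ε p.1.2 φ)

theorem phase_smul (t : Fin r → ℂ) (t₂ : Fin r → Fin r → ℂ) (m : CompactPair Q η → ℂ) (s : ℂ)
    (φ : Fin r → ℂ) :
    phase t t₂ (s • φ) = s * MvPolynomial.eval (timesPoint t t₂ m) (linearPhase Q η φ) +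
      s ^ 2 * MvPolynomial.eval (timesPoint t t₂ m) (quadraticPhase Q η φ) := by
  simp only [phase, linearPhase, quadraticPhase, map_sum, map_mul, MvPolynomial.eval_X,
    MvPolynomial.eval_C, timesPoint, Sum.elim_inl, Sum.elim_inr, Finset.mul_sum, Pi.smul_apply,
    smul_eq_mul]
  congr 1
  · exact Finset.sum_congr rfl fun a _ => by ring
  · exact Finset.sum_congr rfl fun a _ => Finset.sum_congr rfl fun b _ => by ring

theorem divisorForm_smul (ε : Fin N → ℂ) (i : Fin N) (s : ℂ) (φ : Fin r → ℂ) :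
    divisorForm Q (s • ε) i (s • φ) = s * divisorForm Q ε i φ := by
  simp only [divisorForm, Pi.smul_apply, smul_eq_mul, mul_add, Finset.mul_sum]
  congr 1
  exact Finset.sum_congr rfl fun a _ => by ring

theorem pairSum_smul (t : Fin r → ℂ) (t₂ : Fin r → Fin r → ℂ) (m : CompactPair Q η → ℂ) (s : ℂ)
    (ε : Fin N → ℂ) (φ : Fin r → ℂ) :
    pairSum m (s • ε) (s • φ) =
      s ^ 2 * MvPolynomial.eval (timesPoint t t₂ m) (pairPolynomial Q η ε φ) := by
  simp only [pairSum, pairPolynomial, map_sum, map_mul, MvPolynomial.eval_X,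
    MvPolynomial.eval_C, timesPoint, Sum.elim_inr, Finset.mul_sum, divisorForm_smul]
  exact Finset.sum_congr rfl fun a _ => by ring

open Classical in
theorem exists_forall_vertexForm_ne_zero (Q : Matrix (Fin N) (Fin r) ℤ) (η : Fin r → ℝ) :
    ∃ e : Fin N → ℂ, ∀ σ : {σ // IsJKPole Q η σ}, ∀ j ∈ (Finset.univ.image σ.1)ᶜ,
      vertexForm Q σ.1 j e ≠ 0 := by
  obtain ⟨e, he⟩ := Module.Dual.exists_forall_ne_zero_of_forall_exists
    (fun p : {p : {σ // IsJKPole Q η σ} × Fin N // p.2 ∉ Set.range p.1.1} =>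
      (vertexForm Q p.1.1.1 p.1.2 : (Fin N → ℂ) →ₗ[ℂ] ℂ))
    (fun p => ⟨Pi.single p.1.2 1, by simp [vertexForm_single Q p.2]⟩)
  exact ⟨e, fun σ j hj => he ⟨(σ, j), by simpa using hj⟩⟩

-- The direction `e` depends only on `Q` and `η`, so `P` is fixed before the times and `R`. Along `s
-- • e` the vertices and forms scale by `s`, and `R 0` is read off as a Taylor coefficient.
open Classical in
theorem exists_polynomial_value_zero (Q : Matrix (Fin N) (Fin r) ℤ) (η : Fin r → ℝ) :
    ∃ P : MvPolynomial (Fin r ⊕ (Fin r × Fin r) ⊕ CompactPair Q η) ℂ,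
      ∀ (t : Fin r → ℂ) (t₂ : Fin r → Fin r → ℂ) (m : CompactPair Q η → ℂ)
        (R : (Fin N → ℂ) → ℂ), Differentiable ℂ R → (∀ ε,
          (∀ σ : {σ // IsJKPole Q η σ}, ∀ j ∈ (Finset.univ.image σ.1)ᶜ,
            vertexForm Q σ.1 j ε ≠ 0) →
          R ε = ∑ σ : {σ // IsJKPole Q η σ}, poleNumerator t t₂ m σ.1 ε /
            ∏ j ∈ (Finset.univ.image σ.1)ᶜ, vertexForm Q σ.1 j ε) →
        R 0 = MvPolynomial.eval (timesPoint t t₂ m) P := by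
  obtain ⟨e, he⟩ := exists_forall_vertexForm_ne_zero Q η
  -- The number of factors in each denominator. If `N < r` there are no poles and the truncated
  -- value is harmless.
  let d := N - r
  choose p hp using fun σ : {σ // IsJKPole Q η σ} => exists_iteratedDeriv_exp_eq_eval
    (linearPhase Q η (vertex Q σ.1 e)) (quadraticPhase Q η (vertex Q σ.1 e)) d
  choose p' hp' using fun σ : {σ // IsJKPole Q η σ} => exists_iteratedDeriv_exp_eq_eval
    (linearPhase Q η (vertex Q σ.1 e)) (quadraticPhase Q η (vertex Q σ.1 e) +
      pairPolynomial Q η e (vertex Q σ.1 e)) d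
  let w : {σ // IsJKPole Q η σ} → ℂ := fun σ => (‖(chargeMinor Q σ.1).det‖ : ℂ)⁻¹ *
    (∏ j ∈ (Finset.univ.image σ.1)ᶜ, vertexForm Q σ.1 j e)⁻¹
  refine ⟨MvPolynomial.C (d.factorial : ℂ)⁻¹ * ∑ σ, MvPolynomial.C (w σ) * (p σ - p' σ),
    fun t t₂ m R hR hRε => ?_⟩
  set x := timesPoint t t₂ m with hx
  let F : {σ // IsJKPole Q η σ} → ℂ → ℂ := fun σ s =>
    Complex.exp (s * MvPolynomial.eval x (linearPhase Q η (vertex Q σ.1 e)) +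
      s ^ 2 * MvPolynomial.eval x (quadraticPhase Q η (vertex Q σ.1 e)))
  let F' : {σ // IsJKPole Q η σ} → ℂ → ℂ := fun σ s =>
    Complex.exp (s * MvPolynomial.eval x (linearPhase Q η (vertex Q σ.1 e)) +
      s ^ 2 * MvPolynomial.eval x (quadraticPhase Q η (vertex Q σ.1 e) +
        pairPolynomial Q η e (vertex Q σ.1 e)))
  have hFd : ∀ σ, Differentiable ℂ (F σ) := fun σ => by
    simp only [F]
    fun_prop
  have hFd' : ∀ σ, Differentiable ℂ (F' σ) := fun σ => by
    simp only [F']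
    fun_prop
  have hRline : Differentiable ℂ fun s : ℂ => R (s • e) := by fun_prop
  have hne : ∀ s : ℂ, s ≠ 0 → s ^ d * R (s • e) = ∑ σ, w σ * (F σ s - F' σ s) := by
    intro s hs
    rw [hRε (s • e) fun σ j hj => by
      rw [map_smul, smul_eq_mul]
      exact mul_ne_zero hs (he σ j hj), Finset.mul_sum]
    refine Finset.sum_congr rfl fun σ _ => ?_
    have hcard : (Finset.univ.image σ.1)ᶜ.card = d := by
      rw [Finset.card_compl, Finset.card_image_of_injective _ σ.2.1.injective]
      simp [d]
    have hprod : ∏ j ∈ (Finset.univ.image σ.1)ᶜ, vertexForm Q σ.1 j (s • e) =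
        s ^ d * ∏ j ∈ (Finset.univ.image σ.1)ᶜ, vertexForm Q σ.1 j e := by
      simp only [map_smul, smul_eq_mul, Finset.prod_mul_distrib, Finset.prod_const, hcard]
    have hnum : poleNumerator t t₂ m σ.1 (s • e) =
        (‖(chargeMinor Q σ.1).det‖ : ℂ)⁻¹ * (F σ s - F' σ s) := by
      rw [poleNumerator, map_smul, phase_smul t t₂ m, pairSum_smul t t₂ m]
      simp only [F, F', ← hx, map_add, mul_add, add_assoc]
    rw [hprod, hnum, mul_div_assoc', mul_div_mul_left _ _ (pow_ne_zero d hs)]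
    simp only [w]
    ring
  -- The individual fractions are singular at `s = 0`; after multiplication by `s ^ d` both sides
  -- are continuous, so the identity extends there.
  have hall : (fun s : ℂ => s ^ d * R (s • e)) = fun s => ∑ σ, w σ * (F σ s - F' σ s) := by
    refine Continuous.ext_on (dense_compl_singleton (0 : ℂ)) ?_ ?_ fun s hs => hne s hs
    · exact (continuous_pow d).mul hRline.continuous
    · have h1 := fun σ => (hFd σ).continuous
      have h2 := fun σ => (hFd' σ).continuous
      fun_prop
  have hder := iteratedDeriv_pow_mul_zero hRline d
  rw [hall, zero_smul, iteratedDeriv_fun_sum] at hder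
  · have hsum : ∀ σ, iteratedDeriv d (fun s => w σ * (F σ s - F' σ s)) 0 =
        w σ * (MvPolynomial.eval x (p σ) - MvPolynomial.eval x (p' σ)) := by
      intro σ
      rw [← hp, ← hp', iteratedDeriv_const_mul_field, iteratedDeriv_fun_sub
        (hFd σ).contDiff.contDiffAt (hFd' σ).contDiff.contDiffAt]
    rw [Finset.sum_congr rfl fun σ _ => hsum σ] at hder
    simp only [map_mul, map_sum, map_sub, MvPolynomial.eval_C, hder]
    have : (d.factorial : ℂ) ≠ 0 := by exact_mod_cast d.factorial_ne_zero
    field_simp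
  · intro σ _
    exact (((hFd σ).sub (hFd' σ)).const_mul (w σ)).contDiff.contDiffAt

end ToricVolume

end

open ToricVolume
theorem mainTheorem7 {N r : ℕ} (Q : Matrix (Fin N) (Fin r) ℤ) (η : Fin r → ℝ)
    (hη : IsRegularValue Q η) :
    ∃ P : MvPolynomial (Fin r ⊕ (Fin r × Fin r) ⊕ CompactPair Q η) ℂ,
      ∀ (t : Fin r → ℂ) (t₂ : Fin r → Fin r → ℂ) (m : CompactPair Q η → ℂ),
        ∃ R : (Fin N → ℂ) → ℂ,
          Differentiable ℂ R ∧
          R =O[𝓝 0] (fun ε : Fin N → ℂ => ε) ∧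
          ∀ ε : Fin N → ℂ, IsGeneric Q ε →
            generatingFunction Q η ε t t₂
                - Complex.exp (quadShift ε m)
                  * generatingFunction Q η ε (t + psiOne ε m) (t₂ + psiTwo m)
              = MvPolynomial.eval (timesPoint t t₂ m) P + R ε := by
  classical
  obtain ⟨P, hP⟩ := exists_polynomial_value_zero Q η
  refine ⟨P, fun t t₂ m => ?_⟩
  obtain ⟨R, hR, hRε⟩ := exists_entire_difference hη t t₂ m
  have h0 := hP t t₂ m R hR hRε
  -- The error term is the entire extension recentred at its value `R 0`, which is the value of `P`;
  -- differentiability at `0` then gives the bound.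
  refine ⟨fun ε => R ε - R 0, hR.sub_const _, ?_, fun ε hε => ?_⟩
  · simpa using (hR 0).isBigO_sub
  · have hne : ∀ σ, IsJKPole Q η σ → ∀ j ∉ Set.range σ, vertexForm Q σ j ε ≠ 0 :=
      fun σ hσ j hj => vertexForm_ne_zero_of_isGeneric Q hε hσ.1.injective hσ.2.1 hj
    rw [generatingFunction_sub t t₂ m hne, ← h0,
      ← hRε ε fun σ j hj => hne σ.1 σ.2 j (by simpa using hj)]
    ring
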